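/- Let $p$ be a prime number, $K$ a field of characteristic $p$ (not necessarily perfect), and $A$ a finitely generated commutative $K$-algebra. The ring $W^{\dagger}(A)$ of overconvergent Witt vectors is defined as follows. For real weights $d_1,\dots,d_m>0$ the degree valuation on $K[T_1,\dots,T_m]$ is $\nu\bigl(\sum_k c_kT^k\bigr)=\inf\{-(k_1d_1+\dots+k_md_m) : c_k\neq 0\}\in\mathbb{R}\cup\{\infty\}$. A surjection of $K$-algebras $\phi:K[T_1,\dots,T_m]\to A$ induces $\bar\nu(a)=\sup\{\nu(g):\phi(g)=a\}$ on $A$. A function $\nu_A:A\to\mathbb{R}\cup\{\infty\}$ is called an admissible pseudovaluation if - $\nu_A(0)=\infty$, $\nu_A(a\pm b)\ge\min\{\nu_A(a),\nu_A(b)\}$, $\nu_A(ab)\ge\nu_A(a)+\nu_A(b)$, $\nu_A(1)=0$ if $A\neq 0$, and $\nu_A(a)\le 0$ for all $a\neq 0$; and - $\nu_A$ is linearly equivalent to some such $\bar\nu$, i.e. there are real numbers $c_1,c_2>0$ and $d_1',d_2'\ge 0$ with $\nu_A\ge c_2\bar\nu-d_2'$ and $\bar\nu\ge c_1\nu_A-d_1'$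 on $A$. A Witt vector $(a_0,a_1,a_2,\dots)\in W(A)$ ($p$-typical Witt vectors) is overconvergent if there are real numbers $\varepsilon>0$ and $c$ with $$ i+\varepsilon p^{-i}\nu_A(a_i)\ \ge\ c\qquad\text{for all } i\ge 0 .$$ This does not depend on the admissible pseudovaluation $\nu_A$; the overconvergent Witt vectors form a subring $W^{\dagger}(A)\subset W(A)$ containing all Teichmüller representatives $[a]$, $a\in A$, and a homomorphism $A\to B$ of finitely generated $K$-algebras induces a homomorphism $W^{\dagger}(A)\to W^{\dagger}(B)$. **Corollary.** Let $f\in A[T]$ be a monic polynomial of degree $n$ such that $B=A[T]/(f)$ is (finite) étale over $A$. Let $t\in B$ be the residue class of $T$, and let $x=[t]\in W^{\dagger}(B)$ be its Teichmüller representative. Then $W^{\dagger}(B)$ is finite and étale over $W^{\dagger}(A)$, and the elements $1,x,\dots,x^{n-1}$ form a basis of the $W^{\dagger}(A)$-module $W^{\dagger}(B)$. -/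

import Mathlib

open scoped Polynomial

noncomputable section

namespace OverconvergentWitt

/-! ### Pseudovaluations -/

section Pseudovaluations

/-- An order function on an abelian group, with values in `ℝ ∪ {∞} ∪ {-∞}`. -/
structure IsOrderFunction {A : Type*} [AddCommGroup A] (ν : A → EReal) : Prop where
  map_zero : ν 0 = ⊤
  map_add : ∀ a b, min (ν a) (ν b) ≤ ν (a + b)
  map_sub : ∀ a b, min (ν a) (ν b) ≤ ν (a - b)

/-- A pseudovaluation on a commutative ring.  The condition `ν 1 = 0` is only imposed when `1 ≠ 0`,
so that the zero ring carries exactly one pseudovaluation, the constant `∞`. -/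
structure IsPseudovaluation {A : Type*} [CommRing A] (ν : A → EReal) : Prop
    extends IsOrderFunction ν where
  map_one : (1 : A) ≠ 0 → ν 1 = 0
  map_mul : ∀ a b, ν a ≠ ⊥ → ν b ≠ ⊥ → ν a + ν b ≤ ν (a * b)

/-- A pseudovaluation is negative if it is proper (never `-∞`) and is `≤ 0` on nonzero elements. -/
structure IsNegativePseudovaluation {A : Type*} [CommRing A] (ν : A → EReal) : Prop
    extends IsPseudovaluation ν where
  ne_bot : ∀ a, ν a ≠ ⊥
  nonpos : ∀ a, a ≠ 0 → ν a ≤ 0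

/-- Linear equivalence of two functions on `A`. -/
def LinearlyEquivalent {A : Type*} (ν₁ ν₂ : A → EReal) : Prop :=
  ∃ c₁ c₂ d₁ d₂ : ℝ, 0 < c₁ ∧ 0 < c₂ ∧ 0 ≤ d₁ ∧ 0 ≤ d₂ ∧
    ∀ a, (c₂ : EReal) * ν₂ a - (d₂ : EReal) ≤ ν₁ a ∧ (c₁ : EReal) * ν₁ a - (d₁ : EReal) ≤ ν₂ a

/-- The quotient of `ν` along a map `φ`: `b ↦ sup {ν a | φ a = b}`. -/
def quotientFun {A B : Type*} (φ : A → B) (ν : A → EReal) (b : B) : EReal :=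
  ⨆ a, ⨆ _ : φ a = b, ν a

/-- The degree valuation on `K[T₁, …, T_m]` with weights `d₁, …, d_m`, where `K` carries the trivial
valuation: `ν (∑ c_k T^k) = inf {-(k₁ d₁ + ⋯ + k_m d_m) | c_k ≠ 0}`. -/
def degreeValuation {K : Type*} [Field K] {m : ℕ} (d : Fin m → ℝ)
    (f : MvPolynomial (Fin m) K) : EReal :=
  ⨅ k ∈ f.support, ((-∑ i, (k i : ℝ) * d i : ℝ) : EReal)

/-- The admissible pseudovaluations on a finitely generated `K`-algebra `A`: the negative
pseudovaluations linearly equivalent to the quotient of a degree valuation along a surjection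
`K[T₁, …, T_m] → A`. -/
def IsAdmissible (K : Type*) [Field K] {A : Type*} [CommRing A] [Algebra K A]
    (ν : A → EReal) : Prop :=
  IsNegativePseudovaluation ν ∧
    ∃ (m : ℕ) (φ : MvPolynomial (Fin m) K →ₐ[K] A) (d : Fin m → ℝ),
      Function.Surjective φ ∧ (∀ i, 0 < d i) ∧
        LinearlyEquivalent ν (quotientFun φ (degreeValuation d))

theorem IsPseudovaluation.zero_le_one {A : Type*} [CommRing A] {ν : A → EReal}
    (h : IsPseudovaluation ν) : 0 ≤ ν 1 := by
  by_cases h1 : (1 : A) = 0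
  · rw [h1, h.map_zero]; exact le_top
  · rw [h.map_one h1]

theorem IsOrderFunction.neg {A : Type*} [AddCommGroup A] {ν : A → EReal}
    (h : IsOrderFunction ν) {a : A} {r : EReal} (ha : r ≤ ν a) : r ≤ ν (-a) := by
  have := h.map_sub 0 a
  rw [h.map_zero, zero_sub, min_eq_right le_top] at this
  exact ha.trans this

theorem IsOrderFunction.sum {A : Type*} [AddCommGroup A] {ν : A → EReal}
    (h : IsOrderFunction ν) {ι : Type*} (s : Finset ι) (f : ι → A) {r : EReal}
    (hf : ∀ i ∈ s, r ≤ ν (f i)) : r ≤ ν (∑ i ∈ s, f i) := by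
  classical
  induction s using Finset.induction_on with
  | empty => rw [Finset.sum_empty, h.map_zero]; exact le_top
  | insert a s ha ih =>
    rw [Finset.sum_insert ha]
    refine le_trans (le_min (hf a (Finset.mem_insert_self a s)) (ih fun i hi => ?_)) (h.map_add _ _)
    exact hf i (Finset.mem_insert_of_mem hi)

theorem IsPseudovaluation.mul_of_le {A : Type*} [CommRing A] {ν : A → EReal}
    (h : IsPseudovaluation ν) {a b : A} {r s : ℝ} (ha : (r : EReal) ≤ ν a)
    (hb : (s : EReal) ≤ ν b) : ((r + s : ℝ) : EReal) ≤ ν (a * b) := by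
  have ha' : ν a ≠ ⊥ := fun h0 => by simp [h0] at ha
  have hb' : ν b ≠ ⊥ := fun h0 => by simp [h0] at hb
  rw [EReal.coe_add]
  exact (add_le_add ha hb).trans (h.map_mul a b ha' hb')

theorem IsPseudovaluation.pow_of_le {A : Type*} [CommRing A] {ν : A → EReal}
    (h : IsPseudovaluation ν) {a : A} {r : ℝ} (ha : (r : EReal) ≤ ν a) (n : ℕ) :
    ((n * r : ℝ) : EReal) ≤ ν (a ^ n) := by
  induction n with
  | zero => simpa using h.zero_le_one
  | succ n ih =>
    have := h.mul_of_le ih ha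
    rw [pow_succ]
    refine le_trans (le_of_eq ?_) this
    congr 1; push_cast; ring

theorem IsPseudovaluation.prod_of_le {A : Type*} [CommRing A] {ν : A → EReal}
    (h : IsPseudovaluation ν) {ι : Type*} (s : Finset ι) (f : ι → A) (r : ι → ℝ)
    (hf : ∀ i ∈ s, (r i : EReal) ≤ ν (f i)) :
    ((∑ i ∈ s, r i : ℝ) : EReal) ≤ ν (∏ i ∈ s, f i) := by
  classical
  induction s using Finset.induction_on with
  | empty => simpa using h.zero_le_one
  | insert a s ha ih =>
    rw [Finset.sum_insert ha, Finset.prod_insert ha]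
    exact h.mul_of_le (hf a (Finset.mem_insert_self a s))
      (ih fun i hi => hf i (Finset.mem_insert_of_mem hi))

variable {K : Type*} [Field K] {m : ℕ} (d : Fin m → ℝ)

theorem le_degreeValuation_iff {f : MvPolynomial (Fin m) K} {r : EReal} :
    r ≤ degreeValuation d f ↔ ∀ k ∈ f.support, r ≤ ((-∑ i, (k i : ℝ) * d i : ℝ) : EReal) := by
  simp only [degreeValuation, le_iInf_iff]

theorem degreeValuation_C (c : K) :
    0 ≤ degreeValuation d (MvPolynomial.C c : MvPolynomial (Fin m) K) := by
  classical
  rw [le_degreeValuation_iff]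
  intro k hk
  rw [MvPolynomial.mem_support_iff, MvPolynomial.coeff_C] at hk
  have : k = 0 := by
    by_contra h0
    exact hk (if_neg (Ne.symm h0))
  subst this
  simp

theorem degreeValuation_ne_bot (f : MvPolynomial (Fin m) K) : degreeValuation d f ≠ ⊥ := by
  intro h
  have key : ((-∑ k ∈ f.support, |∑ i, (k i : ℝ) * d i| : ℝ) : EReal) ≤ degreeValuation d f := by
    rw [le_degreeValuation_iff]
    intro k hk
    rw [EReal.coe_le_coe_iff, neg_le_neg_iff]
    exact (le_abs_self _).trans
      (Finset.single_le_sum (f := fun k : Fin m →₀ ℕ => |∑ i, (k i : ℝ) * d i|)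
        (fun _ _ => abs_nonneg _) hk)
  rw [h] at key
  simp at key

theorem degreeValuation_add (f g : MvPolynomial (Fin m) K) :
    min (degreeValuation d f) (degreeValuation d g) ≤ degreeValuation d (f + g) := by
  classical
  rw [le_degreeValuation_iff]
  intro k hk
  rcases Finset.mem_union.1 (MvPolynomial.support_add hk) with h | h
  · exact (min_le_left _ _).trans ((le_degreeValuation_iff d).1 le_rfl k h)
  · exact (min_le_right _ _).trans ((le_degreeValuation_iff d).1 le_rfl k h)

theorem degreeValuation_neg (f : MvPolynomial (Fin m) K) :
    degreeValuation d (-f) = degreeValuation d f := by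
  unfold degreeValuation
  rw [MvPolynomial.support_neg]

theorem isPseudovaluation_degreeValuation :
    IsPseudovaluation (degreeValuation (K := K) d) where
  map_zero := by simp [degreeValuation]
  map_add := degreeValuation_add d
  map_sub a b := by
    rw [sub_eq_add_neg, ← degreeValuation_neg d b]
    exact degreeValuation_add d a (-b)
  map_one _ := by
    refine le_antisymm ?_ (by simpa using degreeValuation_C d (1 : K))
    have h : (0 : Fin m →₀ ℕ) ∈ (1 : MvPolynomial (Fin m) K).support := by
      simp
    exact ((le_degreeValuation_iff d).1 le_rfl 0 h).trans (by simp)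
  map_mul f g _ _ := by
    classical
    rw [le_degreeValuation_iff]
    intro k hk
    obtain ⟨k₁, h₁, k₂, h₂, rfl⟩ := Finset.mem_add.1 (MvPolynomial.support_mul f g hk)
    refine (add_le_add ((le_degreeValuation_iff d).1 le_rfl k₁ h₁)
      ((le_degreeValuation_iff d).1 le_rfl k₂ h₂)).trans (le_of_eq ?_)
    rw [← EReal.coe_add]
    congr 1
    simp only [Finsupp.add_apply, Nat.cast_add, add_mul, Finset.sum_add_distrib]
    ring

theorem lt_quotientFun_iff {A B : Type*} {φ : A → B} {ν : A → EReal} {b : B} {r : EReal} :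
    r < quotientFun φ ν b ↔ ∃ a, φ a = b ∧ r < ν a := by
  simp only [quotientFun, lt_iSup_iff, exists_prop]

theorem le_quotientFun {A B : Type*} (φ : A → B) (ν : A → EReal) (a : A) :
    ν a ≤ quotientFun φ ν (φ a) :=
  le_iSup₂_of_le a rfl le_rfl

/-- The quotient of a degree valuation is a negative pseudovaluation. -/
theorem isNegativePseudovaluation_quotientFun {A : Type*} [CommRing A] [Algebra K A]
    (φ : MvPolynomial (Fin m) K →ₐ[K] A) (hφ : Function.Surjective φ) (hd : ∀ i, 0 < d i) :
    IsNegativePseudovaluation (quotientFun φ (degreeValuation d)) := by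
  have hp := isPseudovaluation_degreeValuation (K := K) d
  have nonpos : ∀ a : A, a ≠ 0 → quotientFun φ (degreeValuation d) a ≤ 0 := by
    intro a ha
    refine iSup₂_le fun f hf => ?_
    have hf0 : f ≠ 0 := by
      rintro rfl
      exact ha (by rw [← hf, _root_.map_zero])
    obtain ⟨k, hk⟩ := MvPolynomial.support_nonempty.2 hf0
    refine ((le_degreeValuation_iff d).1 le_rfl k hk).trans ?_
    rw [← EReal.coe_zero, EReal.coe_le_coe_iff, neg_nonpos]
    exact Finset.sum_nonneg fun i _ => mul_nonneg (Nat.cast_nonneg _) (hd i).le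
  refine ⟨⟨⟨?_, ?_, ?_⟩, ?_, ?_⟩, ?_, nonpos⟩
  · refine top_le_iff.1 ?_
    have := le_quotientFun φ (degreeValuation d) 0
    rwa [_root_.map_zero, hp.map_zero] at this
  · intro a b
    refine le_of_forall_lt fun r hr => ?_
    obtain ⟨f, rfl, hf⟩ := lt_quotientFun_iff.1 (lt_min_iff.1 hr).1
    obtain ⟨g, rfl, hg⟩ := lt_quotientFun_iff.1 (lt_min_iff.1 hr).2
    exact lt_quotientFun_iff.2 ⟨f + g, _root_.map_add φ f g, (lt_min hf hg).trans_le (hp.map_add f g)⟩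
  · intro a b
    refine le_of_forall_lt fun r hr => ?_
    obtain ⟨f, rfl, hf⟩ := lt_quotientFun_iff.1 (lt_min_iff.1 hr).1
    obtain ⟨g, rfl, hg⟩ := lt_quotientFun_iff.1 (lt_min_iff.1 hr).2
    exact lt_quotientFun_iff.2 ⟨f - g, _root_.map_sub φ f g, (lt_min hf hg).trans_le (hp.map_sub f g)⟩
  · intro h1
    refine le_antisymm (nonpos 1 h1) ?_
    have := le_quotientFun φ (degreeValuation d) 1
    rw [_root_.map_one] at this
    exact hp.zero_le_one.trans this
  · intro a b _ _
    refine EReal.add_le_of_forall_lt fun r hr s hs => ?_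
    obtain ⟨f, rfl, hf⟩ := lt_quotientFun_iff.1 hr
    obtain ⟨g, rfl, hg⟩ := lt_quotientFun_iff.1 hs
    have := le_quotientFun φ (degreeValuation d) (f * g)
    rw [_root_.map_mul] at this
    exact ((add_le_add hf.le hg.le).trans (hp.map_mul f g (degreeValuation_ne_bot d f)
      (degreeValuation_ne_bot d g))).trans this
  · intro a h
    obtain ⟨f, rfl⟩ := hφ a
    have := le_quotientFun φ (degreeValuation d) f
    rw [h] at this
    exact degreeValuation_ne_bot d f (le_bot_iff.1 this)

theorem exists_isAdmissible (K : Type*) [Field K] (A : Type*) [CommRing A] [Algebra K A]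
    [Algebra.FiniteType K A] : ∃ ν : A → EReal, IsAdmissible K ν := by
  obtain ⟨m, φ, hφ⟩ := Algebra.FiniteType.iff_quotient_mvPolynomial''.1
    (inferInstance : Algebra.FiniteType K A)
  refine ⟨quotientFun φ (degreeValuation fun _ => 1),
    isNegativePseudovaluation_quotientFun _ φ hφ fun _ => one_pos, m, φ, fun _ => 1, hφ,
    fun _ => one_pos, 1, 1, 0, 0, one_pos, one_pos, le_rfl, le_rfl, fun a => ?_⟩
  simp

theorem le_of_mul_sub_le {x y : EReal} {c d r : ℝ} (hc : 0 < c)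
    (h : (c : EReal) * x - (d : EReal) ≤ y) (hr : (r : EReal) ≤ x) :
    ((c * r - d : ℝ) : EReal) ≤ y := by
  refine le_trans ?_ h
  rw [EReal.coe_sub, EReal.coe_mul]
  exact EReal.sub_le_sub (mul_le_mul_of_nonneg_left hr (EReal.coe_nonneg.2 hc.le)) le_rfl

/-- Algebra homomorphisms are linearly bounded for admissible pseudovaluations. -/
theorem IsAdmissible.exists_bound {A B : Type*} [CommRing A] [Algebra K A]
    [CommRing B] [Algebra K B] {ν : A → EReal} {τ : B → EReal}
    (hν : IsAdmissible K ν) (hτ : IsAdmissible K τ) (h : A →ₐ[K] B) :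
    ∃ c D : ℝ, 0 < c ∧ 0 ≤ D ∧ ∀ (a : A) (r : ℝ), (r : EReal) ≤ ν a →
      ((c * r - D : ℝ) : EReal) ≤ τ (h a) := by
  obtain ⟨-, m, φ, d, hφ, hd, c₁, c₂, d₁, d₂, hc₁, hc₂, hd₁, hd₂, hA⟩ := hν
  obtain ⟨-, l, ψ, e, hψ, he, c₃, c₄, d₃, d₄, hc₃, hc₄, hd₃, hd₄, hB⟩ := hτ
  have hp := isPseudovaluation_degreeValuation (K := K) e
  choose g hg using fun i : Fin m => hψ (h (φ (MvPolynomial.X i)))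
  have hreal : ∀ i, ∃ C : ℝ, (C : EReal) ≤ degreeValuation e (g i) := fun i => by
    obtain ⟨C, -, hC⟩ := EReal.lt_iff_exists_real_btwn.1
      (bot_lt_iff_ne_bot.2 (degreeValuation_ne_bot e (g i)))
    exact ⟨C, hC.le⟩
  choose C hC using hreal
  obtain ⟨E, hE, hEC⟩ : ∃ E : ℝ, 0 < E ∧ ∀ i, -(E * d i) ≤ C i := by
    refine ⟨1 + ∑ i, |C i| / d i, ?_, fun i => ?_⟩
    · have : 0 ≤ ∑ i, |C i| / d i :=
        Finset.sum_nonneg fun i _ => div_nonneg (abs_nonneg _) (hd i).le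
      linarith
    · have h1 : |C i| / d i ≤ ∑ i, |C i| / d i :=
        Finset.single_le_sum (f := fun i => |C i| / d i)
          (fun i _ => div_nonneg (abs_nonneg _) (hd i).le) (Finset.mem_univ i)
      have h2 : |C i| ≤ (∑ i, |C i| / d i) * d i := (div_le_iff₀ (hd i)).1 h1
      have h3 := neg_abs_le (C i)
      have h4 := hd i
      nlinarith
  refine ⟨c₄ * E * c₁, c₄ * E * (d₁ + 1) + d₄, by positivity, by positivity, fun a r hr => ?_⟩
  have h1 := le_of_mul_sub_le hc₁ (hA a).2 hr
  have h2 : ((c₁ * r - d₁ - 1 : ℝ) : EReal) < quotientFun φ (degreeValuation d) a :=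
    lt_of_lt_of_le (by rw [EReal.coe_lt_coe_iff]; linarith) h1
  obtain ⟨f, rfl, hf⟩ := lt_quotientFun_iff.1 h2
  have hF : ψ (MvPolynomial.aeval g f) = h (φ f) := by
    have : ψ.comp (MvPolynomial.aeval g) = h.comp φ := by
      refine MvPolynomial.algHom_ext fun i => ?_
      simp [hg]
    exact DFunLike.congr_fun this f
  have h3 : ((E * (c₁ * r - d₁ - 1) : ℝ) : EReal) ≤ degreeValuation e (MvPolynomial.aeval g f) := by
    rw [MvPolynomial.aeval_def, MvPolynomial.eval₂_eq']
    refine hp.sum _ _ fun k hk => ?_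
    have hk' := (le_degreeValuation_iff d).1 hf.le k hk
    rw [EReal.coe_le_coe_iff] at hk'
    have h4 : ((∑ i, (k i : ℝ) * C i : ℝ) : EReal) ≤ degreeValuation e (∏ i, g i ^ k i) :=
      hp.prod_of_le Finset.univ _ _ fun i _ => hp.pow_of_le (hC i) (k i)
    have h5 := hp.mul_of_le (r := 0) (degreeValuation_C e (MvPolynomial.coeff k f)) h4
    refine le_trans ?_ h5
    rw [EReal.coe_le_coe_iff, zero_add]
    calc E * (c₁ * r - d₁ - 1) ≤ E * (-∑ i, (k i : ℝ) * d i) :=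
          mul_le_mul_of_nonneg_left hk' hE.le
      _ = ∑ i, (k i : ℝ) * (-(E * d i)) := by
          rw [mul_neg, Finset.mul_sum, ← Finset.sum_neg_distrib]
          exact Finset.sum_congr rfl fun i _ => by ring
      _ ≤ ∑ i, (k i : ℝ) * C i :=
          Finset.sum_le_sum fun i _ => mul_le_mul_of_nonneg_left (hEC i) (Nat.cast_nonneg _)
  have h6 := h3.trans (le_quotientFun ψ (degreeValuation e) _)
  rw [hF] at h6
  have h7 := le_of_mul_sub_le hc₄ (hB (h (φ f))).1 h6
  refine le_trans (le_of_eq ?_) h7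
  congr 1; ring

end Pseudovaluations

/-! ### Overconvergent Witt vectors -/

section Witt

variable (p : ℕ) [Fact p.Prime]

/-- A Witt vector `(a₀, a₁, …)` is overconvergent with respect to `ν` if for some radius `ε > 0` and
some real constant `c` one has `i + ε p⁻ⁱ ν(aᵢ) ≥ c` for all `i`. -/
def IsOverconvergent {A : Type*} (ν : A → EReal) (α : WittVector p A) : Prop :=
  ∃ ε c : ℝ, 0 < ε ∧
    ∀ i : ℕ, (c : EReal) ≤ (i : EReal) + ((ε * ((p : ℝ) ^ i)⁻¹ : ℝ) : EReal) * ν (α.coeff i)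

theorem le_nat_add_mul_iff {c k : ℝ} (hk : 0 < k) (i : ℕ) (x : EReal) :
    (c : EReal) ≤ (i : EReal) + (k : EReal) * x ↔ (((c - i) / k : ℝ) : EReal) ≤ x := by
  have hi : (i : EReal) = ((i : ℝ) : EReal) := by simp
  rw [hi]
  induction x with
  | bot => simp [EReal.coe_mul_bot_of_pos hk]
  | top =>
    rw [EReal.coe_mul_top_of_pos hk, EReal.coe_add_top]
    simp
  | coe x =>
    rw [← EReal.coe_mul, ← EReal.coe_add, EReal.coe_le_coe_iff, EReal.coe_le_coe_iff,
      div_le_iff₀ hk, sub_le_iff_le_add]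
    constructor <;> intro h <;> linarith

/-- Reformulation of overconvergence with a single constant. -/
theorem isOverconvergent_iff {A : Type*} {ν : A → EReal} {α : WittVector p A} :
    IsOverconvergent p ν α ↔ ∃ C : ℝ, 0 < C ∧
      ∀ i : ℕ, ((-(C * (i + 1) * (p : ℝ) ^ i) : ℝ) : EReal) ≤ ν (α.coeff i) := by
  have hp : (0 : ℝ) < p := Nat.cast_pos.2 (Fact.out : p.Prime).pos
  constructor
  · rintro ⟨ε, c, hε, h⟩
    refine ⟨(|c| + 1) / ε, by positivity, fun i => ?_⟩
    have h1 := (le_nat_add_mul_iff (by positivity) i _).1 (h i)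
    refine le_trans ?_ h1
    rw [EReal.coe_le_coe_iff]
    have h2 : (c - i) / (ε * ((p : ℝ) ^ i)⁻¹) = (c - i) / ε * (p : ℝ) ^ i := by
      field_simp
    rw [h2, ← neg_mul]
    refine mul_le_mul_of_nonneg_right ?_ (by positivity)
    rw [← neg_mul, ← neg_div, div_mul_eq_mul_div]
    refine div_le_div_of_nonneg_right ?_ hε.le
    have h3 := neg_abs_le c
    have h4 : (0 : ℝ) ≤ |c| * i := by positivity
    nlinarith
  · rintro ⟨C, hC, h⟩
    refine ⟨1 / C, -1, by positivity, fun i => ?_⟩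
    rw [le_nat_add_mul_iff (by positivity)]
    refine le_trans (le_of_eq ?_) (h i)
    congr 1
    field_simp
    ring

/-- Multiplication by a Teichmüller representative. -/
theorem coeff_teichmuller_mul {R : Type*} [CommRing R] (s : R) (x : WittVector p R) (n : ℕ) :
    (WittVector.teichmuller p s * x).coeff n = s ^ p ^ n * x.coeff n := by
  have aux : ∀ (R : Type _) [CommRing R] [Invertible (p : R)] (s : R) (x : WittVector p R),
      WittVector.teichmuller p s * x = WittVector.mk p fun n => s ^ p ^ n * x.coeff n := by
    intro R _ _ s x
    apply (WittVector.ghostMap.bijective_of_invertible p R).1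
    rw [map_mul]
    ext1 n
    simp only [Pi.mul_apply, WittVector.ghostMap_apply, WittVector.ghostComponent_teichmuller]
    rw [WittVector.ghostComponent_apply, WittVector.ghostComponent_apply, aeval_wittPolynomial,
      aeval_wittPolynomial, Finset.mul_sum]
    refine Finset.sum_congr rfl fun i hi => ?_
    have hi' : i ≤ n := Nat.lt_succ_iff.1 (Finset.mem_range.1 hi)
    have hpow : p ^ n = p ^ i * p ^ (n - i) := by rw [← pow_add, Nat.add_sub_cancel' hi']
    rw [WittVector.coeff_mk, mul_pow, ← pow_mul, ← hpow]
    ring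
  have aux₂ : ∀ (s : MvPolynomial R ℤ) (x : WittVector p (MvPolynomial R ℤ)),
      WittVector.teichmuller p s * x = WittVector.mk p fun n => s ^ p ^ n * x.coeff n := by
    intro s x
    refine WittVector.map_injective (MvPolynomial.map (Int.castRingHom ℚ))
      (MvPolynomial.map_injective _ Int.cast_injective) ?_
    rw [map_mul, WittVector.map_teichmuller, aux]
    ext n
    simp
  obtain ⟨s, rfl⟩ := MvPolynomial.counit_surjective R s
  obtain ⟨x, rfl⟩ := WittVector.map_surjective (p := p) _ (MvPolynomial.counit_surjective R) x
  rw [← WittVector.map_teichmuller, ← map_mul, aux₂]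
  simp

section Rees

variable {A : Type*} [CommRing A] {ν : A → EReal}

/-- The Rees ring `⨁_r {a | ν a ≥ r}` of a pseudovaluation, inside the group algebra `A[ℝ]`. -/
def reesRing (hν : IsPseudovaluation ν) : Subring (AddMonoidAlgebra A ℝ) where
  carrier := {F | ∀ r : ℝ, (r : EReal) ≤ ν (F.coeff r)}
  zero_mem' r := by
    change (r : EReal) ≤ ν 0
    rw [hν.map_zero]; exact le_top
  one_mem' r := by
    classical
    rw [AddMonoidAlgebra.one_def, AddMonoidAlgebra.coeff_single, Finsupp.single_apply]
    split_ifs with h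
    · subst h; exact hν.zero_le_one
    · rw [hν.map_zero]; exact le_top
  add_mem' {F G} hF hG r := (le_min (hF r) (hG r)).trans (hν.map_add _ _)
  neg_mem' {F} hF r := hν.toIsOrderFunction.neg (hF r)
  mul_mem' {F G} hF hG r := by
    classical
    rw [AddMonoidAlgebra.coeff_mul]
    refine hν.sum _ _ fun a _ => hν.sum _ _ fun b _ => ?_
    dsimp only
    split_ifs with h
    · subst h; exact hν.mul_of_le (hF a) (hG b)
    · rw [hν.map_zero]; exact le_top

theorem single_mem_reesRing (hν : IsPseudovaluation ν) {r : ℝ} {a : A} :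
    AddMonoidAlgebra.single r a ∈ reesRing hν ↔ (r : EReal) ≤ ν a := by
  classical
  constructor
  · intro h
    simpa using h r
  · intro h s
    rw [AddMonoidAlgebra.coeff_single, Finsupp.single_apply]
    split_ifs with hs
    · exact hs ▸ h
    · rw [hν.map_zero]; exact le_top

theorem exists_lift_truncate {R : Type*} [CommRing R] (S : Subring R) (n : ℕ) (x : WittVector p R)
    (hx : ∀ i ≤ n, x.coeff i ∈ S) :
    ∃ y : WittVector p S, WittVector.truncate (n + 1) (WittVector.map S.subtype y) =
      WittVector.truncate (n + 1) x := by
  classical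
  refine ⟨WittVector.mk p fun i => if h : x.coeff i ∈ S then ⟨x.coeff i, h⟩ else 0, ?_⟩
  refine TruncatedWittVector.ext fun i => ?_
  rw [WittVector.coeff_truncate, WittVector.coeff_truncate, WittVector.map_coeff,
    WittVector.coeff_mk, dif_pos (hx i (Nat.lt_succ_iff.1 i.2))]
  rfl

theorem coeff_mem_of_truncate {R : Type*} [CommRing R] (S : Subring R) (n : ℕ) (x : WittVector p R)
    (y : WittVector p S) (h : WittVector.truncate (n + 1) (WittVector.map S.subtype y) =
      WittVector.truncate (n + 1) x) : x.coeff n ∈ S := by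
  have h1 := congrArg (fun z => TruncatedWittVector.coeff (Fin.last n) z) h
  simp only [WittVector.coeff_truncate, WittVector.map_coeff, Fin.val_last] at h1
  rw [← h1]
  exact (y.coeff n).2

/-- The Witt vector `[s^h] α` over the group algebra `A[ℝ]`. -/
def twist (h : ℝ) (α : WittVector p A) : WittVector p (AddMonoidAlgebra A ℝ) :=
  WittVector.teichmuller p (AddMonoidAlgebra.single h 1) *
    WittVector.map (AddMonoidAlgebra.singleZeroRingHom : A →+* AddMonoidAlgebra A ℝ) α

theorem coeff_twist (h : ℝ) (α : WittVector p A) (i : ℕ) :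
    (twist p h α).coeff i = AddMonoidAlgebra.single ((p : ℝ) ^ i * h) (α.coeff i) := by
  rw [twist, coeff_teichmuller_mul, WittVector.map_coeff, AddMonoidAlgebra.single_pow]
  simp [AddMonoidAlgebra.singleZeroRingHom, AddMonoidAlgebra.single_mul_single]

theorem coeff_mem_iff_twist (hν : IsPseudovaluation ν) (h : ℝ) (α : WittVector p A) (i : ℕ) :
    (twist p h α).coeff i ∈ reesRing hν ↔ (((p : ℝ) ^ i * h : ℝ) : EReal) ≤ ν (α.coeff i) := by
  rw [coeff_twist, single_mem_reesRing]

theorem exists_lift_twist (hν : IsPseudovaluation ν) {C D : ℝ} (hCD : C ≤ D) (hC : 0 < C) (n : ℕ)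
    {α : WittVector p A}
    (hα : ∀ i : ℕ, ((-(C * (i + 1) * (p : ℝ) ^ i) : ℝ) : EReal) ≤ ν (α.coeff i)) :
    ∃ y : WittVector p (reesRing hν),
      WittVector.truncate (n + 1) (WittVector.map (reesRing hν).subtype y) =
        WittVector.truncate (n + 1) (twist p (-(D * (n + 1))) α) := by
  refine exists_lift_truncate p _ n _ fun i hi => ?_
  rw [coeff_mem_iff_twist]
  refine le_trans ?_ (hα i)
  rw [EReal.coe_le_coe_iff, mul_comm, neg_mul, neg_le_neg_iff]
  have hi' : (i : ℝ) ≤ n := Nat.cast_le.2 hi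
  have hD : 0 ≤ D := hC.le.trans hCD
  gcongr

theorem twist_add (h : ℝ) (α β : WittVector p A) :
    twist p h (α + β) = twist p h α + twist p h β := by
  rw [twist, twist, twist, map_add, mul_add]

theorem twist_neg (h : ℝ) (α : WittVector p A) : twist p h (-α) = -twist p h α := by
  rw [twist, twist, map_neg, mul_neg]

theorem twist_mul (h h' : ℝ) (α β : WittVector p A) :
    twist p (h + h') (α * β) = twist p h α * twist p h' β := by
  have : AddMonoidAlgebra.single (h + h') (1 : A) =
      AddMonoidAlgebra.single h 1 * AddMonoidAlgebra.single h' 1 := by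
    rw [AddMonoidAlgebra.single_mul_single, one_mul]
  rw [twist, twist, twist, this, map_mul, map_mul]
  ring

theorem IsOverconvergent.add (hν : IsPseudovaluation ν) {α β : WittVector p A}
    (hα : IsOverconvergent p ν α) (hβ : IsOverconvergent p ν β) :
    IsOverconvergent p ν (α + β) := by
  rw [isOverconvergent_iff] at *
  obtain ⟨C, hC, hα⟩ := hα
  obtain ⟨D, hD, hβ⟩ := hβ
  refine ⟨max C D, lt_max_of_lt_left hC, fun n => ?_⟩
  obtain ⟨y, hy⟩ := exists_lift_twist p hν (le_max_left C D) hC n hα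
  obtain ⟨z, hz⟩ := exists_lift_twist p hν (le_max_right C D) hD n hβ
  have := coeff_mem_of_truncate p (reesRing hν) n
    (twist p (-(max C D * (n + 1))) (α + β)) (y + z) (by rw [twist_add]; simp only [map_add, hy, hz])
  rw [coeff_mem_iff_twist] at this
  refine le_trans (le_of_eq ?_) this
  congr 1; ring

theorem IsOverconvergent.neg (hν : IsPseudovaluation ν) {α : WittVector p A}
    (hα : IsOverconvergent p ν α) : IsOverconvergent p ν (-α) := by
  rw [isOverconvergent_iff] at *
  obtain ⟨C, hC, hα⟩ := hα
  refine ⟨C, hC, fun n => ?_⟩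
  obtain ⟨y, hy⟩ := exists_lift_twist p hν le_rfl hC n hα
  have := coeff_mem_of_truncate p (reesRing hν) n
    (twist p (-(C * (n + 1))) (-α)) (-y) (by rw [twist_neg]; simp only [map_neg, hy])
  rw [coeff_mem_iff_twist] at this
  refine le_trans (le_of_eq ?_) this
  congr 1; ring

theorem IsOverconvergent.mul (hν : IsPseudovaluation ν) {α β : WittVector p A}
    (hα : IsOverconvergent p ν α) (hβ : IsOverconvergent p ν β) :
    IsOverconvergent p ν (α * β) := by
  rw [isOverconvergent_iff] at *
  obtain ⟨C, hC, hα⟩ := hα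
  obtain ⟨D, hD, hβ⟩ := hβ
  refine ⟨C + D, add_pos hC hD, fun n => ?_⟩
  obtain ⟨y, hy⟩ := exists_lift_twist p hν le_rfl hC n hα
  obtain ⟨z, hz⟩ := exists_lift_twist p hν le_rfl hD n hβ
  have := coeff_mem_of_truncate p (reesRing hν) n
    (twist p (-(C * (n + 1)) + -(D * (n + 1))) (α * β)) (y * z)
    (by rw [twist_mul]; simp only [map_mul, hy, hz])
  rw [coeff_mem_iff_twist] at this
  refine le_trans (le_of_eq ?_) this
  congr 1; ring

theorem IsOverconvergent.zero (hν : IsPseudovaluation ν) :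
    IsOverconvergent p ν (0 : WittVector p A) := by
  rw [isOverconvergent_iff]
  refine ⟨1, one_pos, fun i => ?_⟩
  rw [WittVector.zero_coeff, hν.map_zero]
  exact le_top

theorem IsOverconvergent.teichmuller (hν : IsPseudovaluation ν) {a : A} (ha : ν a ≠ ⊥) :
    IsOverconvergent p ν (WittVector.teichmuller p a) := by
  rw [isOverconvergent_iff]
  obtain ⟨r, -, hr⟩ := EReal.lt_iff_exists_real_btwn.1 (bot_lt_iff_ne_bot.2 ha)
  refine ⟨|r| + 1, by positivity, fun i => ?_⟩
  rcases Nat.eq_zero_or_pos i with rfl | hi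
  · rw [WittVector.teichmuller_coeff_zero]
    refine le_trans ?_ hr.le
    rw [EReal.coe_le_coe_iff]
    have := neg_abs_le r
    simp only [Nat.cast_zero, pow_zero]
    linarith
  · rw [WittVector.teichmuller_coeff_pos p a i hi, hν.map_zero]
    exact le_top

end Rees

variable {K : Type*} [Field K]

theorem IsOverconvergent.map {A B : Type*} [CommRing A] [Algebra K A] [CommRing B] [Algebra K B]
    {ν : A → EReal} {τ : B → EReal} (hν : IsAdmissible K ν) (hτ : IsAdmissible K τ)
    (h : A →ₐ[K] B) {α : WittVector p A} (hα : IsOverconvergent p ν α) :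
    IsOverconvergent p τ (WittVector.map (h : A →+* B) α) := by
  rw [isOverconvergent_iff] at *
  obtain ⟨C, hC, hα⟩ := hα
  obtain ⟨c, D, hc, hD, hb⟩ := hν.exists_bound hτ h
  refine ⟨c * C + D, by positivity, fun i => ?_⟩
  refine le_trans ?_ (hb _ _ (hα i))
  rw [EReal.coe_le_coe_iff]
  have h1 : (1 : ℝ) ≤ (p : ℝ) ^ i :=
    one_le_pow₀ (Nat.one_le_cast.2 (Fact.out : p.Prime).one_lt.le)
  have h2 : (1 : ℝ) ≤ (i + 1) * (p : ℝ) ^ i :=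
    one_le_mul_of_one_le_of_one_le (by linarith [(Nat.cast_nonneg i : (0 : ℝ) ≤ i)]) h1
  nlinarith

/-- Overconvergence does not depend on the admissible pseudovaluation. -/
theorem IsOverconvergent.of_isAdmissible {A : Type*} [CommRing A] [Algebra K A]
    {ν τ : A → EReal} (hν : IsAdmissible K ν) (hτ : IsAdmissible K τ) {α : WittVector p A}
    (hα : IsOverconvergent p ν α) : IsOverconvergent p τ α := by
  have := hα.map p hν hτ (AlgHom.id K A)
  have h1 : WittVector.map ((AlgHom.id K A : A →ₐ[K] A) : A →+* A) α = α := by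
    ext i
    simp
  rwa [h1] at this

variable (K)

/-- The ring `W†(A)` of overconvergent Witt vectors of a finitely generated `K`-algebra `A`: the Witt
vectors that are overconvergent with respect to an admissible pseudovaluation on `A`
(equivalently all of them, see `mem_overconvergentWitt_iff`). -/
def overconvergentWitt (A : Type*) [CommRing A] [Algebra K A] [Algebra.FiniteType K A] :
    Subring (WittVector p A) where
  carrier := {α | ∃ ν : A → EReal, IsAdmissible K ν ∧ IsOverconvergent p ν α}
  zero_mem' := by
    obtain ⟨ν, hν⟩ := exists_isAdmissible K A
    exact ⟨ν, hν, .zero p hν.1.toIsPseudovaluation⟩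
  one_mem' := by
    obtain ⟨ν, hν⟩ := exists_isAdmissible K A
    have := IsOverconvergent.teichmuller p hν.1.toIsPseudovaluation (hν.1.ne_bot 1)
    rw [map_one] at this
    exact ⟨ν, hν, this⟩
  add_mem' := by
    rintro α β ⟨ν, hν, hα⟩ ⟨τ, hτ, hβ⟩
    exact ⟨ν, hν, hα.add p hν.1.toIsPseudovaluation (hβ.of_isAdmissible p hτ hν)⟩
  mul_mem' := by
    rintro α β ⟨ν, hν, hα⟩ ⟨τ, hτ, hβ⟩
    exact ⟨ν, hν, hα.mul p hν.1.toIsPseudovaluation (hβ.of_isAdmissible p hτ hν)⟩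
  neg_mem' := by
    rintro α ⟨ν, hν, hα⟩
    exact ⟨ν, hν, hα.neg p hν.1.toIsPseudovaluation⟩

theorem mem_overconvergentWitt_iff {A : Type*} [CommRing A] [Algebra K A]
    [Algebra.FiniteType K A] {ν : A → EReal} (hν : IsAdmissible K ν) {α : WittVector p A} :
    α ∈ overconvergentWitt p K A ↔ IsOverconvergent p ν α :=
  ⟨fun ⟨_, hτ, hα⟩ => hα.of_isAdmissible p hτ hν, fun hα => ⟨ν, hν, hα⟩⟩

/-- The Teichmüller representative `[a]`, as an element of `W†(A)`. -/
def overconvergentTeichmuller {A : Type*} [CommRing A] [Algebra K A] [Algebra.FiniteType K A]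
    (a : A) : overconvergentWitt p K A :=
  ⟨WittVector.teichmuller p a, by
    obtain ⟨ν, hν⟩ := exists_isAdmissible K A
    exact ⟨ν, hν, .teichmuller p hν.1.toIsPseudovaluation (hν.1.ne_bot a)⟩⟩

/-- The homomorphism `W†(A) → W†(B)` induced by a homomorphism `A → B` of finitely generated
`K`-algebras, the restriction of `W(A) → W(B)`. -/
def overconvergentMap {A B : Type*} [CommRing A] [Algebra K A] [Algebra.FiniteType K A]
    [CommRing B] [Algebra K B] [Algebra.FiniteType K B] (h : A →ₐ[K] B) :
    overconvergentWitt p K A →+* overconvergentWitt p K B :=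
  (WittVector.map (h : A →+* B)).restrict (overconvergentWitt p K A) (overconvergentWitt p K B) (by
    rintro α ⟨ν, hν, hα⟩
    obtain ⟨τ, hτ⟩ := exists_isAdmissible K B
    exact ⟨τ, hτ, hα.map p hν hτ h⟩)

end Witt

end OverconvergentWitt

end

/-! The engine is a fact about characteristic `p`: since `B = A[T]/(f)` is unramified and generated
by `t`, it is also generated by `t ^ p`. Hence for every `i` the elements `t ^ (j * p ^ i)`, `j <
n`, span `B`, and `n` elements spanning a free module of rank `n` are independent. No perfectness of
`K` enters.

Modulo higher terms, `V^k[c] * x ^ j = V^k([c] * F^k(x ^ j))` has leading coefficient `c * t ^ (j *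
p ^ k)` in position `k`. Looking at leading coefficients gives independence of the `x ^ j` even over
`W(A)` (`eq_zero_of_sum_map_mul_eq_zero`), and successive approximation expands any overconvergent
`β` in them.

The analytic point is that the coefficients of this expansion stay overconvergent. With
pseudovaluations adapted to the basis (`exists_isAdmissible_basis_pow`), solving for the coordinates
in position `k` costs at most `E * p ^ k` (`exists_pow_coordinates_bound`). Overconvergence allows
growth `C * (m + 1) * p ^ m`; for `C` large this cost is absorbed by the passage from `m` to `m +
1`, so all remainders obey one bound (`exists_sub_sum_bounded`, `exists_sum_map_mul_eq`).

For étaleness, the monic relation `F` of degree `n` satisfied by `x` reduces to `f` on constant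
coefficients, so `F'(x)` has constant coefficient `f'(t)`, a unit. The same approximation, with a
single generator, inverts overconvergent vectors with unit constant coefficient
(`isUnit_of_isUnit_coeff_zero`), and `Algebra.Etale.of_basis_pow` concludes. -/

section

open scoped TensorProduct

/-! ### Unramified algebras generated by one element -/

/-- If `A[T]/(f)` is unramified over `A`, then `f'` is invertible at the root. -/
theorem AdjoinRoot.isUnit_aeval_derivative_of_formallyUnramified {A : Type*} [CommRing A]
    (f : A[X]) [Algebra.FormallyUnramified A (AdjoinRoot f)] :
    IsUnit (Polynomial.aeval (AdjoinRoot.root f) (Polynomial.derivative f)) := by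
  set B := AdjoinRoot f
  set t : B := AdjoinRoot.root f
  set d : B := Polynomial.aeval t (Polynomial.derivative f)
  -- Modulo `d`, both `t` and `t + ε` are roots of `f` in the dual numbers over `Q`. Unramifiedness
  -- identifies these two lifts of `B → Q`, so `ε = 0`, which forces `Q = 0`.
  let Q := B ⧸ Ideal.span {d}
  let q : B →ₐ[A] Q := Ideal.Quotient.mkₐ A _
  have ht : Polynomial.aeval t f = 0 := by rw [AdjoinRoot.aeval_eq, AdjoinRoot.mk_self]
  have hqd : q d = 0 := Ideal.Quotient.eq_zero_iff_mem.2 (Ideal.mem_span_singleton_self d)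
  let i : Q →ₐ[A] DualNumber Q := TrivSqZeroExt.inlAlgHom A Q Q
  have h2 : Polynomial.aeval (i (q t) + DualNumber.eps) f = 0 := by
    rw [Polynomial.aeval_add_of_sq_eq_zero _ _ _ (by rw [pow_two, DualNumber.eps_mul_eps]),
      Polynomial.aeval_algHom_apply, Polynomial.aeval_algHom_apply, ht,
      Polynomial.aeval_algHom_apply, Polynomial.aeval_algHom_apply]
    change i (q 0) + i (q d) * DualNumber.eps = 0
    rw [hqd]; simp
  let g₂ : B →ₐ[A] DualNumber Q := AdjoinRoot.liftAlgHom f (Algebra.ofId A _)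
    (i (q t) + DualNumber.eps) h2
  have h : i.comp q = g₂ := by
    refine Algebra.FormallyUnramified.lift_unique_of_ringHom
      (TrivSqZeroExt.fstHom A Q Q : DualNumber Q →+* Q) ⟨2, ?_⟩ _ _ ?_
    · rw [Ideal.zero_eq_bot, eq_bot_iff, pow_two, Ideal.mul_le]
      intro r hr s hs
      rw [RingHom.mem_ker] at hr hs
      change r.fst = 0 at hr
      change s.fst = 0 at hs
      rw [Ideal.mem_bot]
      ext <;> simp [hr, hs]
    · have : ((TrivSqZeroExt.fstHom A Q Q).comp (i.comp q)) =
          (TrivSqZeroExt.fstHom A Q Q).comp g₂ := by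
        apply AdjoinRoot.algHom_ext
        simp [g₂, i, t, B]
      exact congrArg (fun φ : B →ₐ[A] Q => (φ : B →+* Q)) this
  have h3 := congrArg (fun x : DualNumber Q => x.snd) (DFunLike.congr_fun h t)
  have h4 : (0 : Q) = 1 := by simpa [g₂, i, t, B] using h3
  rw [← Ideal.span_singleton_eq_top, ← Ideal.Quotient.subsingleton_iff]
  exact subsingleton_of_zero_eq_one h4

/-- In characteristic `p`, an unramified algebra generated by one element `t` is generated
by `t ^ p`. -/
theorem Algebra.adjoin_pow_eq_top_of_formallyUnramified {A B : Type*} [CommRing A] [CommRing B]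
    [Algebra A B] [Module.Finite A B] [Algebra.FormallyUnramified A B] (p : ℕ) [Fact p.Prime]
    [CharP B p] {t : B} (ht : Algebra.adjoin A {t} = ⊤) : Algebra.adjoin A {t ^ p} = ⊤ := by
  set C := Algebra.adjoin A {t ^ p}
  have hpow : ∀ b : B, b ^ p ∈ C := by
    intro b
    have hb : b ∈ Algebra.adjoin A {t} := ht ▸ Algebra.mem_top
    induction hb using Algebra.adjoin_induction with
    | mem x hx =>
      obtain rfl : x = t := hx
      exact Algebra.subset_adjoin rfl
    | algebraMap r => rw [← map_pow]; exact C.algebraMap_mem _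
    | add x y _ _ hx hy => rw [add_pow_char]; exact add_mem hx hy
    | mul x y _ _ hx hy => rw [mul_pow]; exact mul_mem hx hy
  have : Algebra.FormallyUnramified C B := .of_restrictScalars A C B
  have : Module.Finite C B := .of_restrictScalars_finite A C B
  have hp0 : (p : B ⊗[C] B) = 0 := by
    have h := map_natCast (algebraMap B (B ⊗[C] B)) p
    rw [CharP.cast_eq_zero, map_zero] at h
    exact h.symm
  -- `(1 ⊗ b - b ⊗ 1) ^ p = 1 ⊗ b ^ p - b ^ p ⊗ 1` vanishes because `b ^ p` lies in `C` and can be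
  -- moved across the tensor sign.
  have hnil : KaehlerDifferential.ideal C B ≤ nilradical (B ⊗[C] B) := by
    rw [← KaehlerDifferential.span_range_eq_ideal, Ideal.span_le]
    rintro _ ⟨b, rfl⟩
    refine ⟨p, ?_⟩
    have hp : p.Prime := Fact.out
    dsimp only
    rcases subsingleton_or_nontrivial (B ⊗[C] B) with hs | hs
    · exact Subsingleton.elim _ _
    have : CharP (B ⊗[C] B) p := (CharP.charP_iff_prime_eq_zero hp).2 hp0
    rw [Ideal.zero_eq_bot, Ideal.mem_bot, sub_pow_char, Algebra.TensorProduct.tmul_pow, Algebra.TensorProduct.tmul_pow, one_pow,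
      sub_eq_zero]
    have := TensorProduct.smul_tmul (R := C) (⟨b ^ p, hpow b⟩ : C) (1 : B) (1 : B)
    simpa [Algebra.smul_def] using this.symm
  -- Vanishing differentials make the finitely generated diagonal ideal idempotent, hence generated
  -- by an idempotent; being nilpotent, that idempotent is zero.
  obtain ⟨e, he, hsp⟩ : ∃ e, IsIdempotentElem e ∧
      KaehlerDifferential.ideal C B = Ideal.span {e} :=
    (Ideal.isIdempotentElem_iff_of_fg _ (KaehlerDifferential.ideal_fg C B)).mp <|
      (Ideal.cotangent_subsingleton_iff _).mp <|
        inferInstanceAs <| Subsingleton (Ω[B⁄C])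
  have he0 : e = 0 := by
    obtain ⟨k, hk⟩ := hnil (hsp ▸ Ideal.mem_span_singleton_self e)
    rcases k with _ | k
    · rw [pow_zero] at hk
      rw [← mul_one e, hk, mul_zero]
    · rwa [he.pow_succ_eq] at hk
  -- With the diagonal ideal zero, `C → B` is an epimorphism of rings, and a finite epimorphism is
  -- surjective.
  have hepi : Algebra.IsEpi C B := by
    rw [Algebra.isEpi_iff_forall_one_tmul_eq]
    intro b
    have : (1 ⊗ₜ[C] b - b ⊗ₜ[C] 1 : B ⊗[C] B) ∈ KaehlerDifferential.ideal C B := by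
      rw [← KaehlerDifferential.span_range_eq_ideal]
      exact Ideal.subset_span ⟨b, rfl⟩
    rw [hsp, he0, Ideal.span_singleton_eq_bot.2 rfl, Ideal.mem_bot, sub_eq_zero] at this
    exact this
  have hs : Function.Surjective (algebraMap C B) := Algebra.isEpi_iff_surjective_algebraMap_of_finite.1 hepi
  refine Algebra.eq_top_iff.2 fun b => ?_
  obtain ⟨c, rfl⟩ := hs b
  exact c.2

theorem Polynomial.Monic.exists_sum_eq_of_mem_adjoin {A B : Type*} [CommRing A] [CommRing B]
    [Algebra A B] {h : A[X]} (hh : h.Monic) {s : B} (hs : Polynomial.aeval s h = 0) {b : B}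
    (hb : b ∈ Algebra.adjoin A {s}) :
    ∃ a : Fin h.natDegree → A, b = ∑ j, algebraMap A B (a j) * s ^ (j : ℕ) := by
  rw [Algebra.adjoin_singleton_eq_range_aeval] at hb
  obtain ⟨q, rfl⟩ := hb
  rcases subsingleton_or_nontrivial A with hA | hA
  · have : Subsingleton B := (algebraMap A B).codomain_trivial
    exact ⟨0, Subsingleton.elim _ _⟩
  refine ⟨fun j => (q %ₘ h).coeff j, ?_⟩
  have h1 : Polynomial.aeval s q = Polynomial.aeval s (q %ₘ h) := by
    conv_lhs => rw [← Polynomial.modByMonic_add_div q h]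
    simp [hs]
  change Polynomial.aeval s q = _
  -- The strict degree bound on the remainder needs `h ≠ 1`; if `h = 1`, then `B` is zero.
  by_cases hd : h.natDegree = 0
  · have : h = 1 := hh.natDegree_eq_zero.1 hd
    subst this
    have : Subsingleton B := subsingleton_of_zero_eq_one (by simpa using hs.symm)
    exact Subsingleton.elim _ _
  rw [h1, Polynomial.aeval_eq_sum_range' (n := h.natDegree)
    (Polynomial.natDegree_modByMonic_lt q hh (by rintro rfl; simp at hd)),
    Finset.sum_range]
  simp [Algebra.smul_def]

/-- The element `t ^ p` generates the algebra and is a root of `f` with Frobenius applied to its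
coefficients, which is monic of the same degree. Division by that polynomial keeps the number of
terms equal to `f.natDegree`. -/
theorem AdjoinRoot.exists_sum_pow_char {A : Type*} [CommRing A] (p : ℕ) [Fact p.Prime] [CharP A p]
    {f : A[X]} (hf : f.Monic) [CharP (AdjoinRoot f) p]
    [Algebra.FormallyUnramified A (AdjoinRoot f)] (b : AdjoinRoot f) :
    ∃ a : Fin f.natDegree → A,
      b = ∑ j, algebraMap A (AdjoinRoot f) (a j) * (AdjoinRoot.root f ^ p) ^ (j : ℕ) := by
  have : Module.Finite A (AdjoinRoot f) := hf.finite_adjoinRoot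
  have htop := Algebra.adjoin_pow_eq_top_of_formallyUnramified p (AdjoinRoot.adjoinRoot_eq_top (f := f))
  have hroot : Polynomial.aeval (AdjoinRoot.root f ^ p) (f.map (frobenius A p)) = 0 := by
    have h1 : (algebraMap A (AdjoinRoot f)).comp (frobenius A p) =
        (frobenius (AdjoinRoot f) p).comp (algebraMap A (AdjoinRoot f)) := by
      ext a; simp [frobenius_def]
    rw [Polynomial.aeval_def, Polynomial.eval₂_map, h1, ← frobenius_def p (AdjoinRoot.root f),
      ← Polynomial.hom_eval₂, ← Polynomial.aeval_def]
    rw [AdjoinRoot.aeval_eq, AdjoinRoot.mk_self, map_zero]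
  have := (hf.map (frobenius A p)).exists_sum_eq_of_mem_adjoin hroot (b := b) (htop ▸ Algebra.mem_top)
  rcases subsingleton_or_nontrivial A with hA | hA
  · have : Subsingleton (AdjoinRoot f) := (algebraMap A (AdjoinRoot f)).codomain_trivial
    exact ⟨0, Subsingleton.elim _ _⟩
  rwa [hf.natDegree_map] at this

end

/-! ### Étaleness from a basis of powers -/

/-- A monic polynomial satisfied by an element whose powers form a basis. -/
theorem Module.Basis.exists_monic_aeval_eq_zero {R S : Type*} [CommRing R] [Nontrivial R]
    [CommRing S] [Algebra R S] {n : ℕ} (b : Module.Basis (Fin n) R S) {x : S}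
    (hb : ∀ i, b i = x ^ (i : ℕ)) :
    ∃ F : R[X], F.Monic ∧ F.natDegree = n ∧ Polynomial.aeval x F = 0 := by
  set q : R[X] := ∑ i : Fin n, Polynomial.C (b.repr (x ^ n) i) * Polynomial.X ^ (i : ℕ)
  have hq : q.degree < n := by
    refine lt_of_le_of_lt (Polynomial.degree_sum_le _ _)
      ((Finset.sup_lt_iff (WithBot.bot_lt_coe n)).2 fun i _ => ?_)
    exact (Polynomial.degree_C_mul_X_pow_le _ _).trans_lt (Nat.cast_lt.2 i.2)
  refine ⟨Polynomial.X ^ n - q, Polynomial.monic_X_pow_sub hq, ?_, ?_⟩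
  · refine Polynomial.natDegree_eq_of_degree_eq_some ?_
    rw [Polynomial.degree_sub_eq_left_of_degree_lt (by rwa [Polynomial.degree_X_pow]),
      Polynomial.degree_X_pow]
  · have h := b.sum_repr (x ^ n)
    simp only [hb] at h
    simp [q, ← Algebra.smul_def, h]

/-- An algebra having a basis of powers of a root `x` of `F`, with `F'` invertible at `x`,
is étale. -/
theorem Algebra.Etale.of_basis_pow {R S : Type*} [CommRing R] [CommRing S]
    [Algebra R S] {n : ℕ} (b : Module.Basis (Fin n) R S) {x : S} (hb : ∀ i, b i = x ^ (i : ℕ))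
    {F : R[X]} (hF : F.Monic) (hn : F.natDegree = n) (hx : Polynomial.aeval x F = 0)
    (hu : IsUnit (Polynomial.aeval x (Polynomial.derivative F))) : Algebra.Etale R S := by
  subst hn
  let φ : AdjoinRoot F →ₐ[R] S := AdjoinRoot.liftAlgHom F (Algebra.ofId R S) x hx
  have hφx : φ (AdjoinRoot.root F) = x := AdjoinRoot.liftAlgHom_root _ _ _ _
  -- `φ` carries the power basis of `AdjoinRoot F` to `b`.
  have hφ : Function.Bijective φ := by
    let e := (AdjoinRoot.powerBasis' hF).basis.equiv b (finCongr (AdjoinRoot.powerBasis'_dim hF))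
    have : φ.toLinearMap = e.toLinearMap := by
      refine (AdjoinRoot.powerBasis' hF).basis.ext fun i => ?_
      simp only [AlgHom.toLinearMap_apply, LinearEquiv.coe_coe, e, Module.Basis.equiv_apply, hb]
      rw [PowerBasis.coe_basis, AdjoinRoot.powerBasis'_gen, map_pow, hφx]
      rfl
    have h2 : (φ : AdjoinRoot F → S) = e := funext fun a => DFunLike.congr_fun this a
    rw [h2]
    exact e.bijective
  let e := AlgEquiv.ofBijective φ hφ
  obtain ⟨w, hw⟩ := hu.exists_right_inv
  obtain ⟨u, hu⟩ := AdjoinRoot.mk_surjective (e.symm w)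
  -- Invertibility of `F'` at the root lifts to a Bézout identity between `F'` and `F`. This gives a
  -- standard étale pair whose localising element is `1`, so its ring is `AdjoinRoot F` itself.
  have hcond : ∃ p₁ p₂ k, Polynomial.derivative F * p₁ + F * p₂ = (1 : R[X]) ^ k := by
    have h1 : AdjoinRoot.mk F (Polynomial.derivative F * u - 1) = 0 := by
      rw [map_sub, map_mul, hu, map_one, sub_eq_zero]
      apply e.injective
      rw [map_mul, e.apply_symm_apply, map_one, ← hw, ← AdjoinRoot.aeval_eq]
      congr 1
      change φ _ = _
      rw [← Polynomial.aeval_algHom_apply, hφx]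
    obtain ⟨v, hv⟩ := AdjoinRoot.mk_eq_zero.1 h1
    exact ⟨u, -v, 0, by rw [pow_zero]; linear_combination hv⟩
  let P : StandardEtalePair R := ⟨F, hF, 1, hcond⟩
  have hroot : P.HasMap (AdjoinRoot.root F) :=
    ⟨by rw [AdjoinRoot.aeval_eq, AdjoinRoot.mk_self], by simp [P]⟩
  have hX : Polynomial.eval₂ (Algebra.ofId R P.Ring : R →+* P.Ring) P.X F = 0 := P.hasMap_X.1
  let e' : P.Ring ≃ₐ[R] AdjoinRoot F := AlgEquiv.ofAlgHom (P.lift _ hroot)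
    (AdjoinRoot.liftAlgHom F (Algebra.ofId R P.Ring) P.X hX)
    (by
      apply AdjoinRoot.algHom_ext
      rw [AlgHom.comp_apply, AdjoinRoot.liftAlgHom_root, P.lift_X, AlgHom.id_apply])
    (by
      apply P.hom_ext
      rw [AlgHom.comp_apply, P.lift_X, AdjoinRoot.liftAlgHom_root, AlgHom.id_apply])
  exact .of_equiv (e'.trans e)

noncomputable section

namespace OverconvergentWitt

/-! ### Bounds on Witt vectors via the Rees ring -/

section Bounded

variable (p : ℕ) [Fact p.Prime] {A : Type*} [CommRing A] {ν : A → EReal}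

/-- Multiplying by `[s ^ (-D)]` turns the bounds `-D * p ^ i` into membership of the first `n + 1`
coefficients in the Rees ring. Since Witt vectors of a subring are closed under the operations, such
bounds survive sums without any study of the addition polynomials. -/
theorem exists_lift_twist_of_le (hν : IsPseudovaluation ν) {D : ℝ} (n : ℕ) {α : WittVector p A}
    (hα : ∀ i ≤ n, ((-(D * (p : ℝ) ^ i) : ℝ) : EReal) ≤ ν (α.coeff i)) :
    ∃ y : WittVector p (reesRing hν),
      WittVector.truncate (n + 1) (WittVector.map (reesRing hν).subtype y) =
        WittVector.truncate (n + 1) (twist p (-D) α) := by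
  refine exists_lift_truncate p _ n _ fun i hi => ?_
  rw [coeff_mem_iff_twist]
  refine le_trans (le_of_eq ?_) (hα i hi)
  congr 1; ring

/-- The Witt vectors `α` with `ν(αᵢ) ≥ -D pⁱ` for all `i ≤ n`. -/
def boundedAddSubgroup (hν : IsPseudovaluation ν) (n : ℕ) (D : ℝ) :
    AddSubgroup (WittVector p A) where
  carrier := {α | ∀ i ≤ n, ((-(D * (p : ℝ) ^ i) : ℝ) : EReal) ≤ ν (α.coeff i)}
  zero_mem' i _ := by
    rw [WittVector.zero_coeff, hν.map_zero]
    exact le_top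
  add_mem' {α β} hα hβ i hi := by
    obtain ⟨y, hy⟩ := exists_lift_twist_of_le p hν i fun k hk => hα k (hk.trans hi)
    obtain ⟨z, hz⟩ := exists_lift_twist_of_le p hν i fun k hk => hβ k (hk.trans hi)
    have := coeff_mem_of_truncate p (reesRing hν) i (twist p (-D) (α + β)) (y + z)
      (by rw [twist_add]; simp only [map_add, hy, hz])
    rw [coeff_mem_iff_twist] at this
    refine le_trans (le_of_eq ?_) this
    congr 1; ring
  neg_mem' {α} hα i hi := by
    obtain ⟨y, hy⟩ := exists_lift_twist_of_le p hν i fun k hk => hα k (hk.trans hi)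
    have := coeff_mem_of_truncate p (reesRing hν) i (twist p (-D) (-α)) (-y)
      (by rw [twist_neg]; simp only [map_neg, hy])
    rw [coeff_mem_iff_twist] at this
    refine le_trans (le_of_eq ?_) this
    congr 1; ring

end Bounded

/-! ### Expansion in iterated Verschiebung -/

section Verschiebung

open WittVector

variable {p : ℕ} [Fact p.Prime]

/-- The two summands have disjoint supports, so adding them involves no carries. -/
theorem init_succ {R : Type*} [CommRing R] (x : WittVector p R) (k : ℕ) :
    init (k + 1) x = init k x + verschiebung^[k] (teichmuller p (x.coeff k)) := by
  have hV : ∀ i, (verschiebung^[k] (teichmuller p (x.coeff k))).coeff i =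
      if i = k then x.coeff k else 0 := by
    intro i
    rcases lt_or_ge i k with h | h
    · rw [iterate_verschiebung_coeff_eq_zero _ h, if_neg h.ne]
    · obtain ⟨m, rfl⟩ := Nat.exists_eq_add_of_le' h
      rw [iterate_verschiebung_coeff]
      rcases Nat.eq_zero_or_pos m with rfl | hm
      · simp
      · rw [teichmuller_coeff_pos p _ m hm, if_neg (by omega)]
  have hI : ∀ l i, (init l x).coeff i = if i < l then x.coeff i else 0 := fun l i => by
    simp [init, select, coeff_mk]
  ext i
  rw [coeff_add_of_disjoint]
  · rw [hV, hI, hI]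
    split_ifs <;> first | omega | simp_all
  · intro i
    rw [hV, hI]
    by_cases h : i = k
    · left; rw [if_neg (by omega)]
    · right; rw [if_neg h]

theorem tail_mem_ker_truncate {R : Type*} [CommRing R] (x : WittVector p R) (k : ℕ) :
    tail k x ∈ RingHom.ker (truncate (p := p) (R := R) k) := by
  rw [mem_ker_truncate]
  intro i hi
  simp [tail, select, coeff_mk, hi]

theorem map_iterate_verschiebung {R S : Type*} [CommRing R] [CommRing S] (g : R →+* S)
    (x : WittVector p R) (k : ℕ) :
    map g (verschiebung^[k] x) = verschiebung^[k] (map g x) := by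
  induction k with
  | zero => rfl
  | succ k ih => rw [Function.iterate_succ_apply', Function.iterate_succ_apply', map_verschiebung, ih]

theorem iterate_verschiebung_sum {R ι : Type*} [CommRing R] (s : Finset ι)
    (x : ι → WittVector p R) (k : ℕ) :
    verschiebung^[k] (∑ j ∈ s, x j) = ∑ j ∈ s, verschiebung^[k] (x j) := by
  induction k with
  | zero => rfl
  | succ k ih => simp only [Function.iterate_succ_apply', ih, map_sum]

theorem iterate_verschiebung_sub {R : Type*} [CommRing R] (x y : WittVector p R) (k : ℕ) :
    verschiebung^[k] (x - y) = verschiebung^[k] x - verschiebung^[k] y := by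
  induction k with
  | zero => rfl
  | succ k ih => simp only [Function.iterate_succ_apply', ih, map_sub]

end Verschiebung

/-! ### Expansion of Witt vectors by successive approximation -/

section Expansion

open WittVector

variable {p : ℕ} [Fact p.Prime] {A B : Type*} [CommRing A] [CommRing B]

/-- The projection formula. In characteristic `p` it exposes the leading coefficient `g c * (y.coeff
0) ^ p ^ k`, in position `k`. -/
theorem map_verschiebung_teichmuller_mul (g : A →+* B) (c : A) (y : WittVector p B) (k : ℕ) :
    WittVector.map g (verschiebung^[k] (teichmuller p c)) * y =
      verschiebung^[k] (teichmuller p (g c) * frobenius^[k] y) := by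
  rw [map_iterate_verschiebung, map_teichmuller, iterate_verschiebung_mul_left]

theorem coeff_zero_sum {ι : Type*} (s : Finset ι) (x : ι → WittVector p B) :
    (∑ j ∈ s, x j).coeff 0 = ∑ j ∈ s, (x j).coeff 0 :=
  map_sum (constantCoeff : WittVector p B →+* B) x s

theorem coeff_zero_sub (x y : WittVector p B) : (x - y).coeff 0 = x.coeff 0 - y.coeff 0 :=
  map_sub (constantCoeff : WittVector p B →+* B) x y

variable [CharP B p]

theorem coeff_teichmuller_mul_iterate_frobenius (b : B) (y : WittVector p B) (k m : ℕ) :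
    (teichmuller p b * frobenius^[k] y).coeff m = b ^ p ^ m * y.coeff m ^ p ^ k := by
  rw [coeff_teichmuller_mul, iterate_frobenius_coeff]

/-- Linear independence over Witt vectors can be checked on the Frobenius twists of the
constant coefficients. -/
theorem eq_zero_of_sum_map_mul_eq_zero {ι : Type*} [Fintype ι] (g : A →+* B)
    (y : ι → WittVector p B)
    (hy : ∀ (i : ℕ) (a : ι → A), ∑ j, g (a j) * (y j).coeff 0 ^ p ^ i = 0 → a = 0)
    {α : ι → WittVector p A} (hα : ∑ j, WittVector.map g (α j) * y j = 0) : α = 0 := by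
  have key : ∀ k j, ∀ i < k, (α j).coeff i = 0 := by
    intro k
    induction k with
    | zero => intro j i hi; omega
    | succ k ih =>
      -- Once all coefficients below `k` vanish, each `α j` is `V^k` of its shift; position `k` of
      -- the relation is then a relation between the twisted constant coefficients, to which `hy`
      -- applies.
      have h1 : ∀ j, WittVector.map g (α j) * y j =
          verschiebung^[k] (WittVector.map g ((α j).shift k) * frobenius^[k] (y j)) := by
        intro j
        conv_lhs => rw [eq_iterate_verschiebung (ih j)]
        rw [map_iterate_verschiebung, iterate_verschiebung_mul_left]
      simp only [h1] at hα
      rw [← iterate_verschiebung_sum] at hα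
      have h2 := congrArg (fun z => WittVector.coeff z (0 + k)) hα
      simp only [iterate_verschiebung_coeff, zero_coeff, coeff_zero_sum, mul_coeff_zero, map_coeff,
        iterate_frobenius_coeff, shift_coeff, add_zero] at h2
      have h3 := hy k _ h2
      intro j i hi
      rcases Nat.lt_succ_iff_lt_or_eq.1 hi with h | rfl
      · exact ih j i h
      · exact congrFun h3 j
  funext j
  ext i
  simpa using key (i + 1) j i i.lt_succ_self

variable {ν : A → EReal} {τ : B → EReal}

/-- One approximation step: the `c j` are the coordinates of the leading coefficient `β.coeff k`.
What matters is that the remainder obeys the bound with the same `C`, so the step can be iterated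
indefinitely. -/
theorem exists_sub_sum_bounded {ι : Type*} [Fintype ι] (g : A →+* B) (hτ : IsPseudovaluation τ)
    (hg : ∀ (a : A) (r : ℝ), (r : EReal) ≤ ν a → (r : EReal) ≤ τ (g a))
    (y : ι → WittVector p B) {v E C : ℝ} (hv : 0 ≤ v) (hE : 0 ≤ E) (hC : E + 2 * v ≤ C)
    (hy : ∀ j (m : ℕ), ((-(v * (m + 1) * (p : ℝ) ^ m) : ℝ) : EReal) ≤ τ ((y j).coeff m))
    (hspan : ∀ (i : ℕ) (b : B) (r : ℝ), (r : EReal) ≤ τ b → ∃ a : ι → A,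
      b = ∑ j, g (a j) * (y j).coeff 0 ^ p ^ i ∧
        ∀ j, ((r - E * (p : ℝ) ^ i : ℝ) : EReal) ≤ ν (a j))
    (k : ℕ) (β : WittVector p B) (hk : ∀ i < k, β.coeff i = 0)
    (hβ : ∀ m : ℕ, ((-(C * (m + 1) * (p : ℝ) ^ m) : ℝ) : EReal) ≤ τ (β.coeff m)) :
    ∃ c : ι → A, (∀ j, ((-((C * (k + 1) + E) * (p : ℝ) ^ k) : ℝ) : EReal) ≤ ν (c j)) ∧
      (∀ i < k + 1, (β - ∑ j, WittVector.map g (verschiebung^[k] (teichmuller p (c j))) * y j).coeff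
        i = 0) ∧
      ∀ m : ℕ, ((-(C * (m + 1) * (p : ℝ) ^ m) : ℝ) : EReal) ≤
        τ ((β - ∑ j, WittVector.map g (verschiebung^[k] (teichmuller p (c j))) * y j).coeff m) := by
  obtain ⟨c, hc, hcν⟩ := hspan k (β.coeff k) _ (hβ k)
  have hp : (0 : ℝ) < p := Nat.cast_pos.2 (Fact.out : p.Prime).pos
  have hC0 : 0 ≤ C := by linarith
  have hcν' : ∀ j, ((-((C * (k + 1) + E) * (p : ℝ) ^ k) : ℝ) : EReal) ≤ ν (c j) := fun j => by
    refine le_trans (le_of_eq ?_) (hcν j)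
    congr 1; ring
  have hzero : ∀ i < k + 1,
      (β - ∑ j, WittVector.map g (verschiebung^[k] (teichmuller p (c j))) * y j).coeff i = 0 := by
    intro i hi
    simp only [map_verschiebung_teichmuller_mul]
    rw [← iterate_verschiebung_sum, eq_iterate_verschiebung hk, ← iterate_verschiebung_sub]
    rcases Nat.lt_succ_iff_lt_or_eq.1 hi with h | rfl
    · exact iterate_verschiebung_coeff_eq_zero _ h
    · have := iterate_verschiebung_coeff
        (β.shift i - ∑ j, teichmuller p (g (c j)) * frobenius^[i] (y j)) i 0
      rw [zero_add] at this
      rw [this, coeff_zero_sub, coeff_zero_sum, shift_coeff, add_zero, hc, sub_eq_zero]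
      refine Finset.sum_congr rfl fun j _ => ?_
      rw [coeff_teichmuller_mul_iterate_frobenius, pow_zero, pow_one]
  refine ⟨c, hcν', hzero, fun m => ?_⟩
  rcases Nat.lt_or_ge m (k + 1) with hm | hm
  · rw [hzero m hm, hτ.map_zero]
    exact le_top
  have hkm : (k : ℝ) + 1 ≤ m := by exact_mod_cast hm
  -- For fixed `m`, the single slope `D = C * (m + 1)` dominates every position `i ≤ m`, and vectors
  -- bounded by one slope form a group.
  have hmem : β - ∑ j, WittVector.map g (verschiebung^[k] (teichmuller p (c j))) * y j ∈
      boundedAddSubgroup p hτ m (C * (m + 1)) := by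
    refine sub_mem ?_ (sum_mem fun j _ => ?_)
    · intro i hi
      refine le_trans ?_ (hβ i)
      have hi' : (i : ℝ) ≤ m := Nat.cast_le.2 hi
      rw [EReal.coe_le_coe_iff, neg_le_neg_iff]
      gcongr
    · rw [map_verschiebung_teichmuller_mul]
      intro i hi
      rcases lt_or_ge i k with h | h
      · rw [iterate_verschiebung_coeff_eq_zero _ h, hτ.map_zero]
        exact le_top
      obtain ⟨l, rfl⟩ := Nat.exists_eq_add_of_le' h
      rw [iterate_verschiebung_coeff, coeff_teichmuller_mul_iterate_frobenius]
      refine le_trans ?_ (hτ.mul_of_le (hτ.pow_of_le (hg _ _ (hcν' j)) _)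
        (hτ.pow_of_le (hy j l) _))
      rw [EReal.coe_le_coe_iff]
      have hlm : (l : ℝ) + k ≤ m := by exact_mod_cast hi
      -- For `l = 0` the slack comes from `k + 1 ≤ m`: positions up to `k` have already been
      -- cleared. For `l ≥ 1` it comes from `l + k ≤ m` and `E + v * (l + 1) ≤ (E + 2 * v) * l`,
      -- whence the factor `2` in `hC`.
      have h1 : C * (k + 1) + E + v * (l + 1) ≤ C * (m + 1) := by
        rcases Nat.eq_zero_or_pos l with rfl | hl
        · push_cast; nlinarith
        · have : (1 : ℝ) ≤ l := by exact_mod_cast hl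
          nlinarith
      have h2 := mul_le_mul_of_nonneg_right h1 (pow_nonneg hp.le (l + k))
      push_cast
      rw [pow_add] at h2 ⊢
      linarith
  exact hmem m le_rfl

/-- Overconvergent Witt vectors over `B` are combinations of the `y j` with overconvergent
coefficients over `A`, as soon as this holds with linear control for the Frobenius twists of the
constant coefficients. -/
theorem exists_sum_map_mul_eq {ι : Type*} [Fintype ι] (g : A →+* B) (hτ : IsPseudovaluation τ)
    (hg : ∀ (a : A) (r : ℝ), (r : EReal) ≤ ν a → (r : EReal) ≤ τ (g a))
    (y : ι → WittVector p B) {v E C : ℝ} (hv : 0 ≤ v) (hE : 0 ≤ E) (hC : E + 2 * v ≤ C)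
    (hy : ∀ j (m : ℕ), ((-(v * (m + 1) * (p : ℝ) ^ m) : ℝ) : EReal) ≤ τ ((y j).coeff m))
    (hspan : ∀ (i : ℕ) (b : B) (r : ℝ), (r : EReal) ≤ τ b → ∃ a : ι → A,
      b = ∑ j, g (a j) * (y j).coeff 0 ^ p ^ i ∧
        ∀ j, ((r - E * (p : ℝ) ^ i : ℝ) : EReal) ≤ ν (a j))
    (β : WittVector p B)
    (hβ : ∀ m : ℕ, ((-(C * (m + 1) * (p : ℝ) ^ m) : ℝ) : EReal) ≤ τ (β.coeff m)) :
    ∃ α : ι → WittVector p A, β = ∑ j, WittVector.map g (α j) * y j ∧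
      ∀ j (m : ℕ), ((-((C * (m + 1) + E) * (p : ℝ) ^ m) : ℝ) : EReal) ≤ ν ((α j).coeff m) := by
  choose! c hcν hc0 hcτ using fun k => exists_sub_sum_bounded g hτ hg y hv hE hC hy hspan k
  -- The successive remainders; the digit in position `k` of `α j` is the coefficient chosen for
  -- `res k`.
  let res : ℕ → WittVector p B := fun k => Nat.rec β (fun k r =>
    r - ∑ j, WittVector.map g (verschiebung^[k] (teichmuller p (c k r j))) * y j) k
  have hres : ∀ k, (∀ i < k, (res k).coeff i = 0) ∧
      ∀ m : ℕ, ((-(C * (m + 1) * (p : ℝ) ^ m) : ℝ) : EReal) ≤ τ ((res k).coeff m) := by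
    intro k
    induction k with
    | zero => exact ⟨fun i hi => by omega, hβ⟩
    | succ k ih => exact ⟨hc0 k _ ih.1 ih.2, hcτ k _ ih.1 ih.2⟩
  let α : ι → WittVector p A := fun j => WittVector.mk p fun k => c k (res k) j
  have hα : ∀ k, β = res k + ∑ j, WittVector.map g (init k (α j)) * y j := by
    intro k
    induction k with
    | zero =>
      have : ∀ j, init 0 (α j) = 0 := fun j => by ext i; simp [init, select, coeff_mk]
      simp [this, res]
    | succ k ih =>
      have h1 : res (k + 1) = res k -
        ∑ j, WittVector.map g (verschiebung^[k] (teichmuller p ((α j).coeff k))) * y j := rfl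
      simp only [init_succ, map_add, add_mul, Finset.sum_add_distrib]
      rw [h1]
      conv_lhs => rw [ih]
      ring
  refine ⟨α, ?_, fun j m => hcν m _ (hres m).1 (hres m).2 j⟩
  rw [← sub_eq_zero]
  -- Convergence: the error starts in position `k` or later for every `k`, because both the
  -- remainder and the tails of the `α j` do.
  have hker : ∀ k, β - ∑ j, WittVector.map g (α j) * y j ∈
      RingHom.ker (truncate (p := p) (R := B) k) := by
    intro k
    have h1 : β - ∑ j, WittVector.map g (α j) * y j =
        res k - ∑ j, WittVector.map g (tail k (α j)) * y j := by
      have h2 : ∀ j, WittVector.map g (α j) * y j =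
          WittVector.map g (init k (α j)) * y j + WittVector.map g (tail k (α j)) * y j :=
        fun j => by rw [← add_mul, ← map_add, init_add_tail]
      simp only [h2, Finset.sum_add_distrib]
      conv_lhs => rw [hα k]
      ring
    rw [h1]
    refine sub_mem ((mem_ker_truncate k _).2 (hres k).1) (sum_mem fun j _ => ?_)
    refine Ideal.mul_mem_right _ _ ((mem_ker_truncate k _).2 fun i hi => ?_)
    rw [map_coeff, (mem_ker_truncate k _).1 (tail_mem_ker_truncate (α j) k) i hi, map_zero]
  ext i
  rw [(mem_ker_truncate (i + 1) _).1 (hker (i + 1)) i i.lt_succ_self, zero_coeff]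

/-- The version without explicit constants: the bound for the `y j` is the sum of their individual
constants, and `C` is enlarged to meet both `β` and `E + 2 * v`. -/
theorem exists_isOverconvergent_sum_map_mul_eq {ι : Type*} [Fintype ι] (g : A →+* B)
    (hτ : IsPseudovaluation τ)
    (hg : ∀ (a : A) (r : ℝ), (r : EReal) ≤ ν a → (r : EReal) ≤ τ (g a))
    (y : ι → WittVector p B) {E : ℝ} (hE : 0 ≤ E) (hy : ∀ j, IsOverconvergent p τ (y j))
    (hspan : ∀ (i : ℕ) (b : B) (r : ℝ), (r : EReal) ≤ τ b → ∃ a : ι → A,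
      b = ∑ j, g (a j) * (y j).coeff 0 ^ p ^ i ∧
        ∀ j, ((r - E * (p : ℝ) ^ i : ℝ) : EReal) ≤ ν (a j))
    (β : WittVector p B) (hβ : IsOverconvergent p τ β) :
    ∃ α : ι → WittVector p A, β = ∑ j, WittVector.map g (α j) * y j ∧
      ∀ j, IsOverconvergent p ν (α j) := by
  simp only [isOverconvergent_iff] at hy hβ ⊢
  choose V hV0 hV using hy
  obtain ⟨C₀, hC₀, hβ⟩ := hβ
  have mono : ∀ {C D : ℝ}, C ≤ D → ∀ {γ : WittVector p B},
      (∀ m : ℕ, ((-(C * (m + 1) * (p : ℝ) ^ m) : ℝ) : EReal) ≤ τ (γ.coeff m)) →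
      ∀ m : ℕ, ((-(D * (m + 1) * (p : ℝ) ^ m) : ℝ) : EReal) ≤ τ (γ.coeff m) := by
    intro C D hCD γ h m
    refine le_trans ?_ (h m)
    rw [EReal.coe_le_coe_iff, neg_le_neg_iff]
    gcongr
  have hv : 0 ≤ ∑ j, V j := Finset.sum_nonneg fun j _ => (hV0 j).le
  have hVle : ∀ j, V j ≤ ∑ j, V j := fun j =>
    Finset.single_le_sum (f := V) (fun j _ => (hV0 j).le) (Finset.mem_univ j)
  obtain ⟨α, hα, hαν⟩ := exists_sum_map_mul_eq g hτ hg y hv hE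
    (le_max_right C₀ (E + 2 * ∑ j, V j)) (fun j => mono (hVle j) (hV j)) hspan β
    (mono (le_max_left _ _) hβ)
  have hpos : 0 < max C₀ (E + 2 * ∑ j, V j) := lt_max_of_lt_left hC₀
  refine ⟨α, hα, fun j => ⟨max C₀ (E + 2 * ∑ j, V j) + E, by linarith, fun m => ?_⟩⟩
  refine le_trans ?_ (hαν j m)
  rw [EReal.coe_le_coe_iff, neg_le_neg_iff]
  have hm : (0 : ℝ) ≤ m := Nat.cast_nonneg m
  gcongr
  nlinarith

end Expansion

/-! ### Pseudovaluations adapted to a basis of powers -/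

section PowerBasis

theorem isAdmissible_quotientFun {K C : Type*} [Field K] [CommRing C] [Algebra K C] {m : ℕ}
    (φ : MvPolynomial (Fin m) K →ₐ[K] C) (d : Fin m → ℝ) (hφ : Function.Surjective φ)
    (hd : ∀ i, 0 < d i) : IsAdmissible K (quotientFun φ (degreeValuation d)) :=
  ⟨isNegativePseudovaluation_quotientFun _ φ hφ hd, m, φ, d, hφ, hd, 1, 1, 0, 0, one_pos, one_pos,
    le_rfl, le_rfl, fun a => by simp⟩

theorem exists_pos_forall_neg_le {A ι : Type*} [Fintype ι] {ν : A → EReal} (h : ∀ a, ν a ≠ ⊥)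
    (u : ι → A) : ∃ δ : ℝ, 0 < δ ∧ ∀ i, ((-δ : ℝ) : EReal) ≤ ν (u i) := by
  have hreal : ∀ i, ∃ C : ℝ, (C : EReal) ≤ ν (u i) := fun i => by
    obtain ⟨C, -, hC⟩ := EReal.lt_iff_exists_real_btwn.1 (bot_lt_iff_ne_bot.2 (h (u i)))
    exact ⟨C, hC.le⟩
  choose C hC using hreal
  have h0 : ∀ j ∈ Finset.univ, 0 ≤ |C j| := fun j _ => abs_nonneg _
  refine ⟨1 + ∑ i, |C i|, by linarith [Finset.sum_nonneg h0], fun i => le_trans ?_ (hC i)⟩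
  rw [EReal.coe_le_coe_iff]
  linarith [Finset.single_le_sum h0 (Finset.mem_univ i), neg_abs_le (C i)]

variable {A B : Type*} [CommRing A] [CommRing B] [Algebra A B] {n : ℕ}

/-- Multiplication by `t` has matrix entries bounded below by `-δ`, so each further power of `t`
costs at most `δ`. -/
theorem le_repr_pow {ν : A → EReal} (hν : IsPseudovaluation ν) (b : Module.Basis (Fin n) A B)
    {t : B} (hb : ∀ i, b i = t ^ (i : ℕ)) {δ : ℝ}
    (hδ : ∀ k l : Fin n, ((-δ : ℝ) : EReal) ≤ ν (b.repr (t ^ ((l : ℕ) + 1)) k)) (j : ℕ)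
    (k : Fin n) : ((-(j * δ) : ℝ) : EReal) ≤ ν (b.repr (t ^ j) k) := by
  classical
  induction j generalizing k with
  | zero =>
    have h : t ^ 0 = b ⟨0, k.pos⟩ := (hb ⟨0, k.pos⟩).symm
    rw [h, Module.Basis.repr_self, Finsupp.single_apply]
    split_ifs
    · simpa using hν.zero_le_one
    · rw [hν.map_zero]; exact le_top
  | succ j ih =>
    have h : b.repr (t ^ (j + 1)) k = ∑ l, b.repr (t ^ j) l * b.repr (t ^ ((l : ℕ) + 1)) k := by
      conv_lhs => rw [pow_succ, ← b.sum_repr (t ^ j)]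
      simp [Finset.sum_mul, hb, ← pow_succ]
    rw [h]
    refine hν.sum _ _ fun l _ => le_trans (le_of_eq ?_) (hν.mul_of_le (ih l) (hδ k l))
    congr 1; push_cast; ring

/-- An algebra with a basis of powers admits an admissible pseudovaluation that extends one of the
base and is bounded above by the pseudovaluations of the coordinates. -/
theorem exists_isAdmissible_basis_pow (K : Type*) [Field K] [Algebra K A] [Algebra K B]
    [IsScalarTower K A B] [Algebra.FiniteType K A] (b : Module.Basis (Fin n) A B)
    {t : B} (hb : ∀ i, b i = t ^ (i : ℕ)) :
    ∃ (ν : A → EReal) (τ : B → EReal), IsAdmissible K ν ∧ IsAdmissible K τ ∧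
      (∀ (a : A) (r : ℝ), (r : EReal) ≤ ν a → (r : EReal) ≤ τ (algebraMap A B a)) ∧
      ∀ (x : B) (r : ℝ), (r : EReal) ≤ τ x → ∀ k, (r : EReal) ≤ ν (b.repr x k) := by
  obtain ⟨m, φ, hφ⟩ := Algebra.FiniteType.iff_quotient_mvPolynomial''.1
    (inferInstance : Algebra.FiniteType K A)
  let d : Fin m → ℝ := fun _ => 1
  have hd : ∀ i, 0 < d i := fun _ => one_pos
  set ν := quotientFun φ (degreeValuation d)
  have hν : IsNegativePseudovaluation ν := isNegativePseudovaluation_quotientFun _ φ hφ hd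
  obtain ⟨δ, hδ0, hδ⟩ := exists_pos_forall_neg_le hν.ne_bot
    fun i : Fin n × Fin n => b.repr (t ^ ((i.2 : ℕ) + 1)) i.1
  -- The variable sent to `t` gets weight `δ`, exactly the cost of one multiplication by `t` in
  -- coordinates.
  let e : Fin (m + 1) → ℝ := Fin.cons δ d
  have he : ∀ i, 0 < e i := fun i => by
    refine Fin.cases ?_ (fun j => ?_) i
    · exact hδ0
    · exact hd j
  let g : Fin (m + 1) → B := Fin.cons t fun i => algebraMap A B (φ (MvPolynomial.X i))
  let ψ : MvPolynomial (Fin (m + 1)) K →ₐ[K] B := MvPolynomial.aeval g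
  have hψA : ∀ q, ψ (MvPolynomial.rename Fin.succ q) = algebraMap A B (φ q) := by
    intro q
    have : (ψ.comp (MvPolynomial.rename Fin.succ)) = (IsScalarTower.toAlgHom K A B).comp φ := by
      refine MvPolynomial.algHom_ext fun i => ?_
      simp [ψ, g]
    exact DFunLike.congr_fun this q
  have hψt : ψ (MvPolynomial.X 0) = t := by simp [ψ, g]
  have hψ : Function.Surjective ψ := by
    intro x
    choose q hq using fun k => hφ (b.repr x k)
    refine ⟨∑ k, MvPolynomial.rename Fin.succ (q k) * MvPolynomial.X 0 ^ (k : ℕ), ?_⟩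
    simp only [map_sum, map_mul, map_pow, hψA, hψt, hq]
    conv_rhs => rw [← b.sum_repr x]
    simp [hb, Algebra.smul_def]
  -- A lift can be picked from the defining supremum only below a strict inequality, so the bounds
  -- are proved for all `s < r`.
  have real_le : ∀ {r : ℝ} {x : EReal}, (∀ s : ℝ, s < r → (s : EReal) ≤ x) → (r : EReal) ≤ x := by
    intro r x h
    refine le_of_forall_lt fun z hz => ?_
    obtain ⟨s, hs, hsr⟩ := EReal.lt_iff_exists_real_btwn.1 hz
    exact hs.trans_le (h s (EReal.coe_lt_coe_iff.1 hsr))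
  refine ⟨ν, quotientFun ψ (degreeValuation e), isAdmissible_quotientFun φ d hφ hd,
    isAdmissible_quotientFun ψ e hψ he,
    fun a r hr => real_le fun s hs => ?_, fun x r hr k => real_le fun s hs => ?_⟩
  · obtain ⟨q, rfl, hq⟩ := lt_quotientFun_iff.1
      ((EReal.coe_lt_coe_iff.2 hs).trans_le hr)
    rw [← hψA]
    refine le_trans ?_ (le_quotientFun ψ (degreeValuation e) _)
    rw [le_degreeValuation_iff]
    intro k hk
    rw [MvPolynomial.support_rename_of_injective (Fin.succ_injective m)] at hk
    obtain ⟨k, hk', rfl⟩ := Finset.mem_image.1 hk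
    refine ((le_degreeValuation_iff d).1 hq.le k hk').trans (le_of_eq ?_)
    congr 2
    rw [Fin.sum_univ_succ, Finsupp.mapDomain_of_notMem_range _ _ (by simp)]
    simp [e, Finsupp.mapDomain_apply (Fin.succ_injective m)]
  · obtain ⟨q, rfl, hq⟩ := lt_quotientFun_iff.1
      ((EReal.coe_lt_coe_iff.2 hs).trans_le hr)
    have h1 : b.repr (ψ q) k = ∑ c ∈ q.support,
        φ (MvPolynomial.C (q.coeff c) * ∏ i, MvPolynomial.X i ^ c (Fin.succ i)) *
          b.repr (t ^ c 0) k := by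
      have : ψ q = ∑ c ∈ q.support,
          φ (MvPolynomial.C (q.coeff c) * ∏ i, MvPolynomial.X i ^ c (Fin.succ i)) • t ^ c 0 := by
        change MvPolynomial.aeval g q = _
        rw [MvPolynomial.aeval_def, MvPolynomial.eval₂_eq']
        refine Finset.sum_congr rfl fun c _ => ?_
        rw [Fin.prod_univ_succ, Algebra.smul_def]
        simp only [map_mul, map_prod, map_pow, g, Fin.cons_zero, Fin.cons_succ]
        rw [← MvPolynomial.algebraMap_eq, AlgHom.commutes, ← IsScalarTower.algebraMap_apply]
        ring
      rw [this]
      simp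
    rw [h1]
    refine hν.sum _ _ fun c hc => ?_
    -- The weight of a monomial splits into its `A`-part and `c 0 * δ`; the latter pays for the
    -- coordinates of `t ^ c 0`.
    refine le_trans ?_ (hν.mul_of_le (r := -∑ i, (c (Fin.succ i) : ℝ) * d i) ?_
      (le_repr_pow hν.toIsPseudovaluation b hb (fun k l => hδ (k, l)) (c 0) k))
    · refine ((le_degreeValuation_iff e).1 hq.le c hc).trans (le_of_eq ?_)
      rw [Fin.sum_univ_succ]
      congr 1
      simp [e]
    · refine le_trans ?_ (le_quotientFun φ (degreeValuation d) _)
      have hp := isPseudovaluation_degreeValuation (K := K) d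
      have hX : ∀ i, ((-d i : ℝ) : EReal) ≤
          degreeValuation d (MvPolynomial.X i : MvPolynomial (Fin m) K) := by
        intro i
        rw [le_degreeValuation_iff]
        intro k hk
        rw [MvPolynomial.support_X, Finset.mem_singleton] at hk
        subst hk
        rw [EReal.coe_le_coe_iff, neg_le_neg_iff, Finset.sum_eq_single i]
        · simp
        · intro j _ hj
          simp [hj.symm]
        · simp
      refine le_trans (le_of_eq ?_) (hp.mul_of_le (r := 0) (degreeValuation_C d _)
        (hp.prod_of_le Finset.univ _ _ fun i _ => hp.pow_of_le (hX i) _))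
      simp

/-- Coordinates with respect to the Frobenius twists of a basis of powers are linearly bounded. -/
theorem exists_pow_coordinates_bound (p : ℕ) [Fact p.Prime] [CharP A p] [CharP B p]
    {ν : A → EReal} (hν : IsPseudovaluation ν) (hbot : ∀ a, ν a ≠ ⊥)
    (b : Module.Basis (Fin n) A B) {t : B} (hb : ∀ i, b i = t ^ (i : ℕ))
    (hspan : ∀ x : B, ∃ a : Fin n → A, x = ∑ j, algebraMap A B (a j) * (t ^ p) ^ (j : ℕ)) :
    ∃ E : ℝ, 0 ≤ E ∧ ∀ (i : ℕ) (x : B) (r : ℝ), (∀ k, (r : EReal) ≤ ν (b.repr x k)) →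
      ∃ a : Fin n → A, x = ∑ j, algebraMap A B (a j) * (t ^ (j : ℕ)) ^ p ^ i ∧
        ∀ j, ((r - E * (p : ℝ) ^ i : ℝ) : EReal) ≤ ν (a j) := by
  choose G hG using fun k : Fin n => hspan (t ^ (k : ℕ))
  obtain ⟨E, hE0, hE⟩ := exists_pos_forall_neg_le hbot fun i : Fin n × Fin n => G i.1 i.2
  have hp2 : (2 : ℝ) ≤ p := by exact_mod_cast (Fact.out : p.Prime).two_le
  refine ⟨E, hE0.le, fun i x r hx => ?_⟩
  -- The sharper constant `p ^ i - 1` closes the induction: step `i` costs `E * p ^ i`, and `(p ^ i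
  -- - 1) + p ^ i ≤ p ^ (i + 1) - 1` as `p ≥ 2`.
  suffices h : ∃ a : Fin n → A, x = ∑ j, algebraMap A B (a j) * (t ^ (j : ℕ)) ^ p ^ i ∧
      ∀ j, ((r - E * ((p : ℝ) ^ i - 1) : ℝ) : EReal) ≤ ν (a j) by
    obtain ⟨a, ha, haν⟩ := h
    refine ⟨a, ha, fun j => le_trans ?_ (haν j)⟩
    rw [EReal.coe_le_coe_iff]
    linarith
  induction i with
  | zero =>
    refine ⟨fun j => b.repr x j, ?_, fun j => by simpa using hx j⟩
    conv_lhs => rw [← b.sum_repr x]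
    simp [hb, Algebra.smul_def]
  | succ i ih =>
    obtain ⟨a, ha, haν⟩ := ih
    refine ⟨fun j => ∑ k, a k * G k j ^ p ^ i, ?_, fun j => hν.sum _ _ fun k _ => ?_⟩
    · conv_lhs => rw [ha]
      -- Raise `t ^ k = ∑ G k j * (t ^ p) ^ j` to the power `p ^ i`, which is additive in
      -- characteristic `p`.
      have : ∀ k : Fin n, (t ^ (k : ℕ)) ^ p ^ i =
          ∑ j, algebraMap A B (G k j) ^ p ^ i * (t ^ (j : ℕ)) ^ p ^ (i + 1) := by
        intro k
        conv_lhs => rw [hG k]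
        rw [sum_pow_char_pow]
        refine Finset.sum_congr rfl fun j _ => ?_
        rw [mul_pow]
        congr 1
        ring
      simp only [this, Finset.mul_sum, map_sum, Finset.sum_mul, map_mul, map_pow]
      rw [Finset.sum_comm]
      simp only [mul_assoc]
    · refine le_trans ?_ (hν.mul_of_le (haν k) (hν.pow_of_le (hE (k, j)) (p ^ i)))
      rw [EReal.coe_le_coe_iff]
      have h1 : (1 : ℝ) ≤ (p : ℝ) ^ i := one_le_pow₀ (by linarith)
      push_cast
      rw [pow_succ]
      have h2 : (p : ℝ) ^ i * 2 ≤ (p : ℝ) ^ i * p := by gcongr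
      nlinarith

end PowerBasis

/-! ### Units and expansions over overconvergent Witt vectors -/

section Main

variable (p : ℕ) [Fact p.Prime] (K : Type*) [Field K]

theorem isOverconvergent_one {A : Type*} [CommRing A] {ν : A → EReal}
    (hν : IsNegativePseudovaluation ν) : IsOverconvergent p ν (1 : WittVector p A) := by
  have := IsOverconvergent.teichmuller p hν.toIsPseudovaluation (hν.ne_bot 1)
  rwa [map_one] at this

/-- An overconvergent Witt vector is invertible if its constant coefficient is. -/
theorem isUnit_of_isUnit_coeff_zero {B : Type*} [CommRing B] [CharP B p] [Algebra K B]
    [Algebra.FiniteType K B] (z : overconvergentWitt p K B)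
    (hz : IsUnit ((z : WittVector p B).coeff 0)) : IsUnit z := by
  obtain ⟨ν, hν⟩ := exists_isAdmissible K B
  have hνp := hν.1.toIsPseudovaluation
  obtain ⟨u, hu⟩ := hz.exists_right_inv
  obtain ⟨E, hE0, hE⟩ := exists_pos_forall_neg_le hν.1.ne_bot fun _ : Unit => u
  -- Expand `1` in the one-element family `z` over `B` itself. Coordinates along `z₀ ^ p ^ i` are
  -- obtained by multiplying by `u ^ p ^ i`, where `u` is the inverse of `z₀`.
  obtain ⟨α, hα, hαν⟩ := exists_isOverconvergent_sum_map_mul_eq (ν := ν) (RingHom.id B) hνp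
    (fun _ _ h => h) (fun _ : Unit => (z : WittVector p B)) hE0.le
    (fun _ => (mem_overconvergentWitt_iff p K hν).1 z.2) (by
      intro i b r hr
      refine ⟨fun _ => b * u ^ p ^ i, ?_, fun _ => ?_⟩
      · simp only [Finset.univ_unique, Finset.sum_singleton, RingHom.id_apply]
        rw [mul_assoc, ← mul_pow, mul_comm u, hu, one_pow, mul_one]
      · refine le_trans (le_of_eq ?_) (hνp.mul_of_le hr (hνp.pow_of_le (hE ()) (p ^ i)))
        congr 1; push_cast; ring)
    1 (isOverconvergent_one p hν.1)
  have hid : WittVector.map (RingHom.id B) (α ()) = α () := by ext; simp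
  refine IsUnit.of_mul_eq_one ⟨α (), (mem_overconvergentWitt_iff p K hν).2 (hαν ())⟩ ?_
  refine Subtype.ext ?_
  simp only [Finset.univ_unique, Finset.sum_singleton] at hα
  rw [mul_comm]
  exact (hid ▸ hα).symm

/-- The map `W†(A) → A` sending a Witt vector to its constant coefficient. -/
def overconvergentConstantCoeff (A : Type*) [CommRing A] [Algebra K A] [Algebra.FiniteType K A] :
    overconvergentWitt p K A →+* A :=
  (WittVector.constantCoeff : WittVector p A →+* A).comp (overconvergentWitt p K A).subtype

variable {K} {A : Type*} [CommRing A] [Algebra K A] [Algebra.FiniteType K A] {f : A[X]}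

/-- Linear independence over Witt vectors and generation over overconvergent Witt vectors of the
powers of the Teichmüller representative of the root of `f`. -/
theorem sum_map_mul_teichmuller_pow [CharP A p] [CharP (AdjoinRoot f) p]
    [Algebra.FormallyUnramified A (AdjoinRoot f)] (hf : f.Monic) :
    (∀ α : Fin f.natDegree → WittVector p A,
      ∑ j, WittVector.map (algebraMap A (AdjoinRoot f)) (α j) *
        WittVector.teichmuller p (AdjoinRoot.root f ^ (j : ℕ)) = 0 → α = 0) ∧
    ∀ β ∈ overconvergentWitt p K (AdjoinRoot f), ∃ α : Fin f.natDegree → WittVector p A,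
      (∀ j, α j ∈ overconvergentWitt p K A) ∧
        β = ∑ j, WittVector.map (algebraMap A (AdjoinRoot f)) (α j) *
          WittVector.teichmuller p (AdjoinRoot.root f ^ (j : ℕ)) := by
  let b : Module.Basis (Fin f.natDegree) A (AdjoinRoot f) :=
    (AdjoinRoot.powerBasis' hf).basis.reindex (finCongr (AdjoinRoot.powerBasis'_dim hf))
  have hb : ∀ i, b i = AdjoinRoot.root f ^ (i : ℕ) := by
    intro i
    rw [Module.Basis.reindex_apply, PowerBasis.coe_basis, AdjoinRoot.powerBasis'_gen]
    rfl
  obtain ⟨ν, τ, hν, hτ, hντ, hτν⟩ := exists_isAdmissible_basis_pow K b hb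
  obtain ⟨E, hE0, hE⟩ := exists_pow_coordinates_bound p hν.1.toIsPseudovaluation hν.1.ne_bot b hb
    (AdjoinRoot.exists_sum_pow_char p hf)
  constructor
  · intro α hα
    refine eq_zero_of_sum_map_mul_eq_zero _ _ (fun i => ?_) hα
    simp only [WittVector.teichmuller_coeff_zero]
    let L : (Fin f.natDegree → A) →ₗ[A] AdjoinRoot f :=
      Fintype.linearCombination A fun j => (AdjoinRoot.root f ^ (j : ℕ)) ^ p ^ i
    have hL : Function.Surjective L := by
      intro x
      obtain ⟨δ, -, hδ⟩ := exists_pos_forall_neg_le hν.1.ne_bot fun k => b.repr x k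
      obtain ⟨a, ha, -⟩ := hE i x _ hδ
      refine ⟨a, ?_⟩
      rw [ha, Fintype.linearCombination_apply]
      simp only [Algebra.smul_def]
    -- The twisted powers span; composed with the coordinates of `b`, `L` becomes a surjective
    -- endomorphism of a finite free module, hence injective.
    have hinj : Function.Injective (b.equivFun.toLinearMap ∘ₗ L) :=
      OrzechProperty.injective_of_surjective_endomorphism _ (b.equivFun.surjective.comp hL)
    intro a ha
    refine hinj ?_
    have : L a = 0 := by
      rw [Fintype.linearCombination_apply, ← ha]
      simp only [Algebra.smul_def]
    rw [LinearMap.comp_apply, this, map_zero, map_zero]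
  · intro β hβ
    obtain ⟨α, hα, hαν⟩ := exists_isOverconvergent_sum_map_mul_eq (ν := ν)
      (algebraMap A (AdjoinRoot f)) hτ.1.toIsPseudovaluation hντ
      (fun j : Fin f.natDegree => WittVector.teichmuller p (AdjoinRoot.root f ^ (j : ℕ))) hE0
      (fun j => .teichmuller p hτ.1.toIsPseudovaluation (hτ.1.ne_bot _))
      (fun i x r hr => by
        simp only [WittVector.teichmuller_coeff_zero]
        exact hE i x r (hτν x r hr))
      β ((mem_overconvergentWitt_iff p K hτ).1 hβ)
    exact ⟨α, fun j => (mem_overconvergentWitt_iff p K hν).2 (hαν j), hα⟩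

end Main

end OverconvergentWitt

end

/-! ### The basis and étaleness -/

theorem mainTheorem2 (p : ℕ) [Fact p.Prime] (K : Type*) [Field K] [CharP K p]
    (A : Type*) [CommRing A] [Algebra K A] [Algebra.FiniteType K A]
    (n : ℕ) (f : A[X]) (hf : f.Monic) (hn : f.natDegree = n)
    [Algebra.Etale A (AdjoinRoot f)] :
    letI : Algebra (OverconvergentWitt.overconvergentWitt p K A)
        (OverconvergentWitt.overconvergentWitt p K (AdjoinRoot f)) :=
      (OverconvergentWitt.overconvergentMap p K
        (IsScalarTower.toAlgHom K A (AdjoinRoot f))).toAlgebra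
    Module.Finite (OverconvergentWitt.overconvergentWitt p K A)
        (OverconvergentWitt.overconvergentWitt p K (AdjoinRoot f)) ∧
      Algebra.Etale (OverconvergentWitt.overconvergentWitt p K A)
        (OverconvergentWitt.overconvergentWitt p K (AdjoinRoot f)) ∧
      ∃ b : Module.Basis (Fin n) (OverconvergentWitt.overconvergentWitt p K A)
          (OverconvergentWitt.overconvergentWitt p K (AdjoinRoot f)),
        ∀ i : Fin n, b i =
          OverconvergentWitt.overconvergentTeichmuller p K (AdjoinRoot.root f) ^ (i : ℕ) := by
  subst hn
  let _ : Algebra (OverconvergentWitt.overconvergentWitt p K A)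
      (OverconvergentWitt.overconvergentWitt p K (AdjoinRoot f)) :=
    (OverconvergentWitt.overconvergentMap p K
      (IsScalarTower.toAlgHom K A (AdjoinRoot f))).toAlgebra
  let R := OverconvergentWitt.overconvergentWitt p K A
  let S := OverconvergentWitt.overconvergentWitt p K (AdjoinRoot f)
  let x : S := OverconvergentWitt.overconvergentTeichmuller p K (AdjoinRoot.root f)
  -- The zero ring does not have characteristic `p`, so this case is separate; there `n = 0`, and
  -- the empty basis with `F = 1` works.
  rcases subsingleton_or_nontrivial (AdjoinRoot f) with hB | hB
  · have hn0 : f.natDegree = 0 := by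
      rcases subsingleton_or_nontrivial A with hA | hA
      · exact Polynomial.natDegree_of_subsingleton
      by_contra h0
      have := (AdjoinRoot.powerBasis' hf).basis.ne_zero ⟨0, by
        rw [AdjoinRoot.powerBasis'_dim]; omega⟩
      exact this (Subsingleton.elim _ _)
    have hS : Subsingleton S :=
      ⟨fun a b => Subtype.ext (WittVector.ext fun i => Subsingleton.elim _ _)⟩
    have : IsEmpty (Fin f.natDegree) := by rw [hn0]; infer_instance
    let b : Module.Basis (Fin f.natDegree) R S := Module.Basis.empty S
    have hbx : ∀ i, b i = x ^ (i : ℕ) := fun i => isEmptyElim i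
    refine ⟨.of_basis b, ?_, b, hbx⟩
    exact .of_basis_pow b hbx (F := 1) Polynomial.monic_one (by simp [hn0])
      (Subsingleton.elim _ _) (isUnit_of_subsingleton _)
  have hA : Nontrivial A := (algebraMap A (AdjoinRoot f)).domain_nontrivial
  have : CharP A p := charP_of_injective_algebraMap (algebraMap K A).injective p
  have : CharP (AdjoinRoot f) p :=
    charP_of_injective_algebraMap (algebraMap K (AdjoinRoot f)).injective p
  obtain ⟨hinj, hsurj⟩ := OverconvergentWitt.sum_map_mul_teichmuller_pow (K := K) p hf
  have hcoe : ∀ a : Fin f.natDegree → R, ((∑ j, a j • x ^ (j : ℕ) : S) : WittVector p (AdjoinRoot f))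
      = ∑ j, WittVector.map (algebraMap A (AdjoinRoot f)) (a j) *
        WittVector.teichmuller p (AdjoinRoot.root f ^ (j : ℕ)) := by
    intro a
    rw [AddSubmonoidClass.coe_finsetSum]
    refine Finset.sum_congr rfl fun j _ => ?_
    rw [map_pow]
    rfl
  have hli : LinearIndependent R fun j : Fin f.natDegree => x ^ (j : ℕ) := by
    rw [Fintype.linearIndependent_iff]
    intro a ha j
    have h0 := hinj (fun j => (a j : WittVector p A)) (by rw [← hcoe, ha]; rfl)
    exact Subtype.ext (congrFun h0 j)
  have hsp : ⊤ ≤ Submodule.span R (Set.range fun j : Fin f.natDegree => x ^ (j : ℕ)) := by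
    rintro β -
    obtain ⟨α, hα, hβ⟩ := hsurj β β.2
    have : β = ∑ j, (⟨α j, hα j⟩ : R) • x ^ (j : ℕ) := Subtype.ext (by rw [hcoe]; exact hβ)
    rw [this]
    exact sum_mem fun j _ => Submodule.smul_mem _ _ (Submodule.subset_span ⟨j, rfl⟩)
  let b : Module.Basis (Fin f.natDegree) R S := Module.Basis.mk hli hsp
  have hbx : ∀ i, b i = x ^ (i : ℕ) := fun i => Module.Basis.mk_apply hli hsp i
  refine ⟨.of_basis b, ?_, b, hbx⟩
  obtain ⟨F, hF, hFn, hFx⟩ := b.exists_monic_aeval_eq_zero hbx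
  refine .of_basis_pow b hbx hF hFn hFx (OverconvergentWitt.isUnit_of_isUnit_coeff_zero p K _ ?_)
  let cA : R →+* A := OverconvergentWitt.overconvergentConstantCoeff p K A
  let cB : S →+* AdjoinRoot f := OverconvergentWitt.overconvergentConstantCoeff p K (AdjoinRoot f)
  have hc : cB.comp (algebraMap R S) = (algebraMap A (AdjoinRoot f)).comp cA := rfl
  have hcx : cB x = AdjoinRoot.root f := WittVector.teichmuller_coeff_zero p _
  have hcq : ∀ q : R[X], cB (Polynomial.aeval x q) =
      Polynomial.aeval (AdjoinRoot.root f) (q.map cA) := by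
    intro q
    rw [Polynomial.aeval_def, Polynomial.hom_eval₂, hc, hcx, Polynomial.aeval_def,
      Polynomial.eval₂_map]
  -- Taking constant coefficients in `F(x) = 0` shows that the reduction of `F` vanishes at the root
  -- of `f`. Both polynomials are monic of the same degree, so they coincide.
  have hdvd : f ∣ F.map cA := by
    rw [← AdjoinRoot.mk_eq_zero, ← AdjoinRoot.aeval_eq, ← hcq, hFx, map_zero]
  have hFf : F.map cA = f := Polynomial.eq_of_monic_of_dvd_of_natDegree_le hf (hF.map cA) hdvd
    (by rw [hF.natDegree_map, hFn])
  change IsUnit (cB (Polynomial.aeval x (Polynomial.derivative F)))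
  rw [hcq, ← Polynomial.derivative_map, hFf]
  exact AdjoinRoot.isUnit_aeval_derivative_of_formallyUnramified f
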